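/- Let $d\ge 1$. An instance of $d$-dimensional Vector Bin Packing is a finite sequence $I$ of vectors in $[0,1]^d$, and $\mathrm{OPT}(I)$ is the least $m$ such that $I$ can be partitioned into $m$ bins with $\bigl\|\sum_{v\in B} v\bigr\|_\infty\le 1$ for every bin $B$. A (deterministic, one-pass) streaming algorithm receives the vectors one at a time, in arbitrary order. Its memory is made of words. A word stores either a non-negative integer or an integer linear combination of numbers from the input. Upon receiving a vector the algorithm updates its memory by finitely many steps: the next step is determined by the stored integers alone; a step either compares two available numbers (stored numbers and coordinates of the current vector), or an available number with a rational constant, and updates the stored integers according to the outcome, or replaces the stored numbers by integer linear combinations of available numbers and updates the stored integers, or passes on to the next vector, again updating the stored integers. After the last vector it outputs a natural number depending only on the contents of its memory; this final computation is unrestricted. Its memory usage on $I$ is the maximal number of words in use at any step. **Theorem.** There are absolute constants $C>0$ and $c\in\mathbb N$ such that for every integer $d\ge 1$ and every real $0<\varepsilon\le 1$ there is a streaming algorithm that, on every instance $I$ of $d$-dimensional Vector Bin Packing, processes the whole stream, uses at most $$S = C\cdot\frac d\varepsilon\cdot\log\Bigl(2+\frac d\varepsilon\Bigr)\cdot\log\bigl(2+\mathrm{OPT}(I)\bigr)$$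 words of memory, and outputs a number $\mathrm{ALG}(I)$ with $$\mathrm{OPT}(I)\ \le\ \mathrm{ALG}(I)\ \le\ (d+\varepsilon)\cdot \mathrm{OPT}(I)+S .$$ Throughout, if $N$ is the length of $I$, all stored integers and all coefficients of the stored linear combinations (as combinations of the input numbers) can be bounded in absolute value by $(N+d+1/\varepsilon+2)^c$, i.e. they have $O(\log(N+d+1/\varepsilon))$ bits. Moreover, for every $d\ge1$ and every such instance $I$, if $I'$ is the scalar Bin Packing instance obtained from $I$ by replacing each vector $v$ by an item of size $\|v\|_\infty$, then $\mathrm{OPT}(I')\le d\cdot\mathrm{OPT}(I)$. -/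

import Mathlib

open scoped BigOperators

namespace VBP

/-! ### The packing problem -/

/-- An item of `d`-dimensional vector bin packing: every coordinate lies between `0` and `1`. -/
def IsItem {d : ℕ} (v : Fin d → ℝ) : Prop := ∀ k, 0 ≤ v k ∧ v k ≤ 1

/-- The items of `I` can be packed into `m` bins (some possibly empty).  The norm on `Fin d → ℝ` is
the supremum norm, which on vectors with nonnegative coordinates is the largest coordinate. -/
def CanPack {d : ℕ} (I : List (Fin d → ℝ)) (m : ℕ) : Prop :=
  ∃ f : Fin I.length → Fin m, ∀ b : Fin m, ‖∑ i with f i = b, I.get i‖ ≤ 1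

/-- The optimal number of bins.  The set below contains `I.length` whenever `I` consists of items
(one bin for each item), so that the infimum is then a minimum. -/
noncomputable def OPT {d : ℕ} (I : List (Fin d → ℝ)) : ℕ := sInf {m | CanPack I m}

/-- The scalar instance in which each vector is replaced by one item whose size is its supremum
norm; scalar bin packing is the case of dimension one. -/
noncomputable def scalarInstance {d : ℕ} (I : List (Fin d → ℝ)) : List (Fin 1 → ℝ) :=
  I.map fun v _ => ‖v‖

/-! ### One-pass streaming algorithms and their memory

The memory consists of integer words and of number words.  The whole state of an algorithm is kept
in this memory: there is no control state outside of it.  The next instruction is chosen by looking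
at the integer words only.  The numbers, those stored and those of the current item, cannot be
inspected otherwise than by comparing two of them, or one of them with a rational constant, and
number words can only be computed by forming integer linear combinations of numbers. -/

/-- The memory contents. -/
structure Memory where
  /-- the integer words (counters, pointers, program counter, etc.) -/
  ints : List ℕ
  /-- the number words -/
  nums : List ℝ

/-- The number of memory words in use. -/
def Memory.words (s : Memory) : ℕ := s.ints.length + s.nums.length

/-- A number that an instruction can access: a number word (`0` when there is no such word), or a
coordinate of the current item of the stream. -/
inductive Source (d : ℕ) where
  | word (i : ℕ)
  | coord (k : Fin d)

/-- The value of a source, given the number words and the current item. -/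
noncomputable def Source.eval {d : ℕ} (nums : List ℝ) (v : Fin d → ℝ) : Source d → ℝ
  | .word i => nums.getD i 0
  | .coord k => v k

/-- Formal integer linear combinations of accessible numbers. -/
abbrev LinComb (d : ℕ) := List (ℤ × Source d)

/-- The value of a linear combination. -/
noncomputable def LinComb.eval {d : ℕ} (nums : List ℝ) (v : Fin d → ℝ) (e : LinComb d) : ℝ :=
  (e.map fun t => (t.1 : ℝ) * t.2.eval nums v).sum

/-- The instructions. -/
inductive Instr (d : ℕ) where
  /-- if `a ≤ b`, the integer words become `yes`, and otherwise `no` -/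
  | compare (a b : Source d) (yes no : List ℕ)
  /-- if `a ≤ q`, the integer words become `yes`, and otherwise `no` -/
  | compareConst (a : Source d) (q : ℚ) (yes no : List ℕ)
  /-- the number words become the values of the linear combinations `es` (all of them evaluated in
  the old memory), and the integer words become `ints` -/
  | assign (es : List (LinComb d)) (ints : List ℕ)
  /-- the current item has been processed and is dropped, and the integer words become `ints` -/
  | next (ints : List ℕ)

/-- A deterministic one-pass streaming algorithm for `d`-dimensional vectors.  It starts without
number words.  After the last item, it returns a number of bins, which depends on nothing but the
memory contents; this final computation is not restricted. -/
structure StreamingAlgorithm (d : ℕ) where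
  /-- the initial integer words -/
  init : List ℕ
  /-- the instruction to be executed, chosen from the integer words -/
  instr : List ℕ → Instr d
  /-- the final answer -/
  output : Memory → ℕ

namespace StreamingAlgorithm

variable {d : ℕ}

open Classical in
/-- One step of the computation: the memory contents and the part of the stream that has not been
processed, whose first element is the current item.  The computation stops at the end of the
stream. -/
noncomputable def step (A : StreamingAlgorithm d) :
    Memory × List (Fin d → ℝ) → Option (Memory × List (Fin d → ℝ))
  | (_, []) => none
  | (s, v :: rest) =>
    match A.instr s.ints with
    | .compare a b yes no =>
        some (⟨if a.eval s.nums v ≤ b.eval s.nums v then yes else no, s.nums⟩, v :: rest)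
    | .compareConst a q yes no =>
        some (⟨if a.eval s.nums v ≤ (q : ℝ) then yes else no, s.nums⟩, v :: rest)
    | .assign es ints =>
        some (⟨ints, es.map fun e => e.eval s.nums v⟩, v :: rest)
    | .next ints =>
        some (⟨ints, s.nums⟩, rest)

/-- On the input stream `I`, the computation of `A` reaches, after finitely many steps, the memory
contents `s` with the part `rest` of the stream left. -/
def Reaches (A : StreamingAlgorithm d) (I : List (Fin d → ℝ)) (s : Memory)
    (rest : List (Fin d → ℝ)) : Prop :=
  Relation.ReflTransGen (fun x y => A.step x = some y) (⟨A.init, []⟩, I) (s, rest)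

end StreamingAlgorithm

/-- Every word of the memory `s` holds what a single word is allowed to hold, on the input `I`: an
integer word is at most `B`, and a number word is a linear combination of the numbers in the input
whose coefficients are integers of absolute value at most `B`. -/
def Memory.FitsInWords {d : ℕ} (s : Memory) (I : List (Fin d → ℝ)) (B : ℝ) : Prop :=
  (∀ n ∈ s.ints, (n : ℝ) ≤ B) ∧
  ∀ x ∈ s.nums, ∃ c : Fin I.length → Fin d → ℤ,
    (∀ i k, |(c i k : ℝ)| ≤ B) ∧ x = ∑ i, ∑ k, (c i k : ℝ) * I.get i k

/-- The quantity `(d / ε) * log (d / ε) * log OPT`, with `2` added inside the logarithms in order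
to keep them away from `0`. -/
noncomputable def spaceBound (d : ℕ) (ε : ℝ) (opt : ℕ) : ℝ :=
  (d / ε) * Real.log (2 + d / ε) * Real.log (2 + opt)

end VBP

namespace VBP

/-! ### Ages and levels -/

/-! Replace every vector by its supremum norm. A packing of the vectors splits, according to the
coordinate in which the norm is attained, into a packing of the norms with `d` times as many bins
(`packs_norms`); conversely, by the triangle inequality, a packing of the norms packs the vectors
(`canPack_of_packs`). It therefore suffices to estimate scalar bin packing up to a factor `1 + O(ε /
d)` and an additive term.

Let `2 ^ m` be between `16 d / ε` and `64 d / ε`. Norms of at most `2 ^ (-m)` are merely summed;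
they fit greedily on top of any packing with enough free volume (`Packs.greedy`). The others fall
into `m` dyadic size classes, and each class keeps a quantile summary in the manner of Greenwald and
Khanna: a sorted list of numbers, each standing for itself and for numbers below it that were merged
into it. Time advances by one per block of arrivals. The invariants `Valid` imply that at time `T`
rounding lifts at most `T` numbers over any threshold (`countP_val_lt_le`), so the rounded class `j`
is dominated by the true class plus `T` copies of `2 ^ (-j)` (`ClsInv.reps_dominated`). Domination
carries packings over (`Dominated.packs`), and the added copies have volume at most `2 ^ (1 - m)`
times the true volume, plus `m * 2 ^ m` (`Data.slack_sum_le`). This gives `OPT_le_answer` and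
`answer_le`.

For the memory, tuples are sorted into levels by the dyadic size of their age. If no merging is
possible, each level has at most `8 B + 1` tuples, where `B` bounds the arrivals per time step
(`length_le_of_stuck`). There are about `log T` levels, and with blocks of length `2 ^ m`
throughout, `log T` could be of order `m` even for small `OPT`, which costs a logarithm. Hence the
early blocks have length only `2 ^ r` with `m = 2 * r`: early on `r * 2 ^ r` is below `2 ^ m`, and
once the long blocks begin, the class is so full that `OPT` exceeds `2 ^ r` and `log T = O(log OPT)`
(`sizeBound_add_blockSize_le`). -/

/-- At time `T`, the time `τ` is recent at scale `a`. -/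
def Near (a T τ : ℕ) : Prop := 2 * T / 2 ^ a ≤ 2 * τ / 2 ^ a + 1

instance (a T τ : ℕ) : Decidable (Near a T τ) := by unfold Near; infer_instance

lemma Near.succ {a T τ : ℕ} (h : Near a T τ) : Near (a + 1) T τ := by
  unfold Near at *
  rw [pow_succ, ← Nat.div_div_eq_div_mul, ← Nat.div_div_eq_div_mul]
  omega

lemma Near.mono {a b T τ : ℕ} (h : Near a T τ) (hab : a ≤ b) : Near b T τ := by
  induction b, hab using Nat.le_induction with
  | base => exact h
  | succ n _ ih => exact ih.succ

lemma near_log (T τ : ℕ) : Near (Nat.log 2 T + 1) T τ := by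
  unfold Near
  have h : T < 2 ^ (Nat.log 2 T + 1) := Nat.lt_pow_succ_log_self (by norm_num) T
  have : 2 * T / 2 ^ (Nat.log 2 T + 1) < 2 := by
    rw [Nat.div_lt_iff_lt_mul (by positivity)]; omega
  exact (Nat.le_of_lt_succ this).trans (Nat.le_add_left _ _)

lemma exists_near (T τ : ℕ) : ∃ a, Near a T τ := ⟨_, near_log T τ⟩

lemma Near.of_le {a T τ τ' : ℕ} (h : Near a T τ) (hτ : τ ≤ τ') : Near a T τ' := by
  unfold Near at *
  have : 2 * τ / 2 ^ a ≤ 2 * τ' / 2 ^ a := Nat.div_le_div_right (by omega)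
  omega

lemma Near.lt {a T τ : ℕ} (h : Near a T τ) : T < τ + 2 ^ a := by
  unfold Near at h
  have hp : 0 < 2 ^ a := by positivity
  have h1 : 2 * T < 2 ^ a * (2 * T / 2 ^ a + 1) := Nat.lt_mul_div_succ _ hp
  have h2 : 2 ^ a * (2 * τ / 2 ^ a) ≤ 2 * τ := Nat.mul_div_le _ _
  have h3 : 2 ^ a * (2 * T / 2 ^ a + 1) ≤ 2 ^ a * (2 * τ / 2 ^ a + 1 + 1) :=
    Nat.mul_le_mul_left _ (by omega)
  nlinarith

lemma lt_of_not_near {a T τ : ℕ} (h : ¬ Near a T τ) : 2 * τ + 2 ^ a < 2 * T := by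
  unfold Near at h
  have hp : 0 < 2 ^ a := by positivity
  have h1 : 2 * τ < 2 ^ a * (2 * τ / 2 ^ a + 1) := Nat.lt_mul_div_succ _ hp
  have h2 : 2 ^ a * (2 * T / 2 ^ a) ≤ 2 * T := Nat.mul_div_le _ _
  have h3 : 2 ^ a * (2 * τ / 2 ^ a + 1 + 1) ≤ 2 ^ a * (2 * T / 2 ^ a) :=
    Nat.mul_le_mul_left _ (by omega)
  nlinarith

/-- The level of the time `τ` at time `T`: roughly the binary logarithm of its age. -/
def level (T τ : ℕ) : ℕ := Nat.find (exists_near T τ)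

lemma level_le_iff {T τ a : ℕ} : level T τ ≤ a ↔ Near a T τ := by
  constructor
  · intro h
    exact (Nat.find_spec (exists_near T τ) : Near (level T τ) T τ).mono h
  · intro h
    exact Nat.find_min' (exists_near T τ) h

lemma level_le_log (T τ : ℕ) : level T τ ≤ Nat.log 2 T + 1 := level_le_iff.2 (near_log T τ)

lemma level_anti {T τ τ' : ℕ} (h : τ ≤ τ') : level T τ' ≤ level T τ :=
  level_le_iff.2 ((level_le_iff.1 le_rfl).of_le h)

lemma level_min (T τ τ' : ℕ) : level T (min τ τ') = max (level T τ) (level T τ') := by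
  rcases le_total τ τ' with h | h
  · rw [min_eq_left h, max_eq_left (level_anti h)]
  · rw [min_eq_right h, max_eq_right (level_anti h)]

lemma lt_of_level_le {T τ a : ℕ} (h : level T τ ≤ a) : T < τ + 2 ^ a := (level_le_iff.1 h).lt

lemma level_pos {T τ : ℕ} (h : τ < T) : 0 < level T τ := by
  by_contra h0
  have := lt_of_level_le (T := T) (τ := τ) (a := 0) (by omega)
  simp at this; omega

/-- Counterpart of `lt_of_level_le`: a positive level `a` means an age between `2 ^ a / 4` and `2 ^
a`. The lower bound comes from the failure of `Near` at scale `a - 1`. -/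
lemma pow_lt_of_le_level {T τ a : ℕ} (ha : 0 < a) (h : a ≤ level T τ) :
    2 ^ a < 4 * (T - τ) := by
  obtain ⟨b, rfl⟩ : ∃ b, a = b + 1 := ⟨a - 1, by omega⟩
  have : ¬ Near b T τ := fun hn => by
    have := level_le_iff.2 hn; omega
  have := lt_of_not_near this
  rw [pow_succ]; omega

/-- If the rounded time at scale `a` jumps, the window of scale `a` at time `T + 1` is a window of
the next smaller scale at time `T`. In units of `2 ^ (a - 2)` the jump makes the new time even, and
both conditions become `u ≤ u' + 1`, where `u` and `u'` are the rounded `T` and `τ'`. The scales `0`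
and `1` are separate because these units do not exist there. -/
lemma near_succ_time {a T τ : ℕ} (hτ : τ ≤ T) (h : Near a (T + 1) τ)
    (hne : 2 * T / 2 ^ a ≠ 2 * (T + 1) / 2 ^ a) :
    ∃ b, Near b T τ ∧ ∀ τ' ≤ T, Near b T τ' → Near a (T + 1) τ' := by
  rcases a with _ | _ | a
  · exfalso; unfold Near at h; simp at h; omega
  · refine ⟨0, ?_, ?_⟩
    · unfold Near at *; simp at *; omega
    · intro τ' _ h'; unfold Near at *; simp at *; omega
  · have e : ∀ x : ℕ, 2 * x / 2 ^ (a + 1) = x / 2 ^ a := by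
      intro x; rw [pow_succ', Nat.mul_div_mul_left _ _ (by norm_num)]
    have e2 : ∀ x : ℕ, 2 * x / 2 ^ (a + 2) = x / 2 ^ a / 2 := by
      intro x; rw [pow_succ', Nat.mul_div_mul_left _ _ (by norm_num), pow_succ,
        Nat.div_div_eq_div_mul]
    have hs : (T + 1) / 2 ^ a ≤ T / 2 ^ a + 1 := by
      have hp : 0 < 2 ^ a := by positivity
      rw [← Nat.add_div_right _ hp]
      exact Nat.div_le_div_right (by omega)
    have hm : T / 2 ^ a ≤ (T + 1) / 2 ^ a := Nat.div_le_div_right (by omega)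
    refine ⟨a + 1, ?_, ?_⟩
    · unfold Near at *
      simp only [e, e2] at *
      omega
    · intro τ' _ h'
      unfold Near at *
      simp only [e, e2] at *
      omega

/-- Level sets only coalesce as time passes, so a comparison of levels made at a merging stays true
for ever. This is what makes `lev` and `hist` persist. -/
lemma level_succ_time {T x y : ℕ} (hx : x ≤ T) (hy : y ≤ T) (h : level T x ≤ level T y) :
    level (T + 1) x ≤ level (T + 1) y := by
  rw [level_le_iff]
  have hn : Near (level (T + 1) y) (T + 1) y := level_le_iff.1 le_rfl
  set a := level (T + 1) y
  by_cases he : 2 * T / 2 ^ a = 2 * (T + 1) / 2 ^ a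
  · have : Near a T y := by unfold Near at *; omega
    have : Near a T x := level_le_iff.1 (h.trans (level_le_iff.2 this))
    unfold Near at *; omega
  · obtain ⟨b, hb, hb'⟩ := near_succ_time hy hn he
    exact hb' x hx (level_le_iff.1 (h.trans (level_le_iff.2 hb)))

/-! ### Summaries of a stream of numbers -/

/-- A tuple of a summary: the stored number, the time of its arrival, and the list of the numbers
that have been merged into it, with the times of their arrivals. -/
structure Tup where
  val : ℝ
  time : ℕ
  abs : List (ℝ × ℕ)

/-- All numbers that a tuple stands for. -/
def Tup.items (t : Tup) : List (ℝ × ℕ) := (t.val, t.time) :: t.abs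

/-- What is stored about a tuple besides its value. -/
def Tup.code (t : Tup) : ℕ × ℕ := (t.abs.length + 1, t.time)

/-- All numbers that a summary stands for. -/
def allItems (l : List Tup) : List (ℝ × ℕ) := l.flatMap Tup.items

@[simp] lemma allItems_nil : allItems [] = [] := rfl
@[simp] lemma allItems_cons (t : Tup) (l : List Tup) :
    allItems (t :: l) = t.items ++ allItems l := rfl
@[simp] lemma allItems_append (l l' : List Tup) :
    allItems (l ++ l') = allItems l ++ allItems l' := List.flatMap_append

/-- The number of items merged into `q` whose level exceeds that of the time `μ`. -/
def hi (T μ : ℕ) (q : Tup) : ℕ := q.abs.countP (fun x => level T μ < level T x.2)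

/-- For a tuple of time `p`, the list of the tuples on its right: those that contain an item of
high level, compared to the tuples in between, had room for these items at time `p`. -/
def Good (T p : ℕ) : ℕ → List Tup → Prop
  | _, [] => True
  | μ, q :: l => (hi T μ q = 0 ∨ hi T μ q + q.time ≤ p) ∧ Good T p (min μ q.time) l

/-- `Good` for all tuples of the list. -/
def Hist (T : ℕ) : List Tup → Prop
  | [] => True
  | p :: l => Good T p.time p.time l ∧ Hist T l

/-- At most `t.time` numbers below `t.val` have been merged into tuples on the right of `t`. -/
def Jump : List Tup → Prop
  | [] => True
  | t :: l => (allItems l).countP (fun x => x.1 < t.val) ≤ t.time ∧ Jump l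

/-- The earliest time in a list, and `μ`. -/
def minTime (μ : ℕ) (l : List Tup) : ℕ := l.foldl (fun m t => min m t.time) μ

@[simp] lemma minTime_nil (μ : ℕ) : minTime μ [] = μ := rfl
@[simp] lemma minTime_cons (μ : ℕ) (t : Tup) (l : List Tup) :
    minTime μ (t :: l) = minTime (min μ t.time) l := rfl

lemma level_minTime_le {T μ a : ℕ} {l : List Tup} :
    level T (minTime μ l) ≤ a ↔ level T μ ≤ a ∧ ∀ t ∈ l, level T t.time ≤ a := by
  induction l generalizing μ with
  | nil => simp
  | cons t l ih => simp [ih, level_min, and_assoc]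

lemma good_append {T p μ : ℕ} {l l' : List Tup} :
    Good T p μ (l ++ l') ↔ Good T p μ l ∧ Good T p (minTime μ l) l' := by
  induction l generalizing μ with
  | nil => simp [Good]
  | cons t l ih => simp [Good, ih, and_assoc]

lemma hist_append_right {T : ℕ} {l l' : List Tup} (h : Hist T (l ++ l')) : Hist T l' := by
  induction l with
  | nil => exact h
  | cons t l ih => exact ih h.2

lemma hi_anti {T μ μ' : ℕ} (h : level T μ ≤ level T μ') (q : Tup) : hi T μ' q ≤ hi T μ q := by
  refine List.countP_mono_left fun x _ => ?_
  simp only [decide_eq_true_eq]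
  omega

/-- Raising the level of `μ` makes fewer items count as high. -/
lemma Good.mono {T p μ μ' : ℕ} {l : List Tup} (hg : Good T p μ l)
    (h : level T μ ≤ level T μ') : Good T p μ' l := by
  induction l generalizing μ μ' with
  | nil => trivial
  | cons q l ih =>
    refine ⟨?_, ih hg.2 ?_⟩
    · have := hi_anti h q
      have := hg.1
      omega
    · rw [level_min, level_min]; exact max_le_max h le_rfl

/-! #### The invariants of a summary -/

/-- The invariants of a summary at time `T`. -/
structure Valid (T : ℕ) (l : List Tup) : Prop where
  sorted : l.Pairwise fun s t => s.val ≤ t.val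
  -- The arrival time of a tuple is the rank uncertainty it was born with; together with what it has
  -- absorbed, this may not exceed the current time.
  cap : ∀ t ∈ l, t.abs.length + t.time ≤ T
  dom : ∀ t ∈ l, ∀ x ∈ t.abs, x.1 ≤ t.val
  lev : ∀ t ∈ l, ∀ x ∈ t.abs, level T x.2 ≤ level T t.time
  times : ∀ x ∈ allItems l, x.2 ≤ T
  -- `jump` is what accuracy rests on; `hist` serves only the bound on the length.
  jump : Jump l
  hist : Hist T l

lemma valid_nil (T : ℕ) : Valid T [] where
  sorted := List.Pairwise.nil
  cap := by simp
  dom := by simp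
  lev := by simp
  times := by simp
  jump := trivial
  hist := trivial

lemma mem_allItems {l : List Tup} {x : ℝ × ℕ} :
    x ∈ allItems l ↔ ∃ t ∈ l, x = (t.val, t.time) ∨ x ∈ t.abs := by
  simp [allItems, Tup.items]

lemma Valid.time_le {T : ℕ} {l : List Tup} (h : Valid T l) {t : Tup} (ht : t ∈ l) :
    t.time ≤ T := by have := h.cap t ht; omega

lemma Valid.abs_time_le {T : ℕ} {l : List Tup} (h : Valid T l) {t : Tup} (ht : t ∈ l)
    {x : ℝ × ℕ} (hx : x ∈ t.abs) : x.2 ≤ T :=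
  h.times x (mem_allItems.2 ⟨t, ht, .inr hx⟩)

/-- At every threshold, at most `T` numbers have moved from below the threshold to it or above. -/
lemma countP_val_lt_le {T : ℕ} {l : List Tup} (hs : l.Pairwise fun s t => s.val ≤ t.val)
    (hc : ∀ t ∈ l, t.abs.length + t.time ≤ T) (hj : Jump l) {y : ℝ} (hy : ∀ t ∈ l, y ≤ t.val) :
    (allItems l).countP (fun x => x.1 < y) ≤ T := by
  cases l with
  | nil => simp
  | cons t l =>
    -- The numbers below `y` are either among those absorbed by the first tuple, whose own value is
    -- not below `y`, or to its right, where `Jump` bounds them by `t.time`. Then `cap` bounds the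
    -- sum.
    have h1 : t.items.countP (fun x => x.1 < y) ≤ t.abs.length := by
      rw [Tup.items, List.countP_cons_of_neg]
      · exact List.countP_le_length
      · simpa using hy t (by simp)
    have h2 : (allItems l).countP (fun x => x.1 < y) ≤ t.time := by
      refine le_trans (List.countP_mono_left fun x _ => ?_) hj.1
      simp only [decide_eq_true_eq]
      exact fun h => h.trans_le (hy t (by simp))
    have := hc t (by simp)
    rw [allItems_cons, List.countP_append]
    omega

lemma jump_append_right {l l' : List Tup} (h : Jump (l ++ l')) : Jump l' := by
  induction l with
  | nil => exact h
  | cons t l ih => exact ih h.2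

/-! #### Insertion -/

/-- A new tuple. -/
def Tup.new (v : ℝ) (T : ℕ) : Tup := ⟨v, T, []⟩

/-- Tuples on the left see one more number on their right, but not below their value. For the new
tuple the allowance is the current time, which is what `countP_val_lt_le` provides. -/
lemma jump_insert {A C : List Tup} {v : ℝ} {T : ℕ} (h : Jump (A ++ C))
    (hA : ∀ t ∈ A, t.val < v) (hC : (allItems C).countP (fun x => x.1 < v) ≤ T) :
    Jump (A ++ Tup.new v T :: C) := by
  induction A with
  | nil => exact ⟨hC, h⟩
  | cons t A ih =>
    refine ⟨?_, ih h.2 fun s hs => hA s (by simp [hs])⟩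
    have := h.1
    have hv : ¬ v < t.val := not_lt.2 (hA t (by simp)).le
    simpa [List.countP_append, Tup.items, Tup.new, hv] using this

/-- The origin of `Hist`: for a tuple arriving now, `cap` is the second alternative of `Good` for
everything to its right. -/
lemma good_of_cap {T μ : ℕ} {l : List Tup} (hc : ∀ t ∈ l, t.abs.length + t.time ≤ T) :
    Good T T μ l := by
  induction l generalizing μ with
  | nil => trivial
  | cons q l ih =>
    refine ⟨.inr ?_, ih fun t ht => hc t (by simp [ht])⟩
    have : hi T μ q ≤ q.abs.length := List.countP_le_length
    have := hc q (by simp)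
    omega

/-- The new tuple has absorbed nothing, and its time can only raise the level of the running
minimum. -/
lemma good_insert {T p μ T' : ℕ} {A C : List Tup} {v : ℝ} (h : Good T p μ (A ++ C)) :
    Good T p μ (A ++ Tup.new v T' :: C) := by
  rw [good_append] at h ⊢
  refine ⟨h.1, .inl (by simp [hi, Tup.new]), h.2.mono (level_anti (min_le_left _ _))⟩

lemma hist_insert {T : ℕ} {A C : List Tup} {v : ℝ} (h : Hist T (A ++ C))
    (hc : ∀ t ∈ C, t.abs.length + t.time ≤ T) : Hist T (A ++ Tup.new v T :: C) := by
  induction A with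
  | nil => exact ⟨good_of_cap hc, h⟩
  | cons t A ih => exact ⟨good_insert h.1, ih h.2⟩

lemma Valid.insert {T : ℕ} {A C : List Tup} {v : ℝ} (h : Valid T (A ++ C))
    (hA : ∀ t ∈ A, t.val < v) (hC : ∀ t ∈ C, v ≤ t.val) :
    Valid T (A ++ Tup.new v T :: C) where
  sorted := by
    have := h.sorted
    rw [List.pairwise_append] at this ⊢
    refine ⟨this.1, List.pairwise_cons.2 ⟨fun t ht => hC t ht, this.2.1⟩, ?_⟩
    intro a ha b hb
    rcases List.mem_cons.1 hb with rfl | hb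
    · exact (hA a ha).le
    · exact this.2.2 a ha b hb
  cap t ht := by
    rcases List.mem_append.1 ht with h1 | h1
    · exact h.cap t (by simp [h1])
    rcases List.mem_cons.1 h1 with rfl | h1
    · simp [Tup.new]
    · exact h.cap t (by simp [h1])
  dom t ht := by
    rcases List.mem_append.1 ht with h1 | h1
    · exact h.dom t (by simp [h1])
    rcases List.mem_cons.1 h1 with rfl | h1
    · simp [Tup.new]
    · exact h.dom t (by simp [h1])
  lev t ht := by
    rcases List.mem_append.1 ht with h1 | h1
    · exact h.lev t (by simp [h1])
    rcases List.mem_cons.1 h1 with rfl | h1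
    · simp [Tup.new]
    · exact h.lev t (by simp [h1])
  times x hx := by
    have := h.times x
    simp only [allItems_append, allItems_cons, List.mem_append, Tup.items, Tup.new,
      List.mem_cons, List.not_mem_nil, or_false] at hx this
    rcases hx with hx | rfl | hx
    · exact this (.inl hx)
    · exact le_rfl
    · exact this (.inr hx)
  jump := by
    refine jump_insert h.jump hA ?_
    have hs := h.sorted
    rw [List.pairwise_append] at hs
    exact countP_val_lt_le hs.2.1 (fun t ht => h.cap t (by simp [ht]))
      (jump_append_right h.jump) hC
  hist := hist_insert h.hist fun t ht => h.cap t (by simp [ht])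

/-! #### Passing to the next time -/

lemma hi_succ_le {T μ : ℕ} {q : Tup} (hμ : μ ≤ T) (hq : ∀ x ∈ q.abs, x.2 ≤ T) :
    hi (T + 1) μ q ≤ hi T μ q := by
  refine List.countP_mono_left fun x hx => ?_
  simp only [decide_eq_true_eq]
  contrapose!
  exact level_succ_time (hq x hx) hμ

lemma Good.succ {T p μ : ℕ} {l : List Tup} (h : Good T p μ l) (hμ : μ ≤ T)
    (hl : ∀ q ∈ l, ∀ x ∈ q.abs, x.2 ≤ T) : Good (T + 1) p μ l := by
  induction l generalizing μ with
  | nil => trivial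
  | cons q l ih =>
    refine ⟨?_, ih h.2 ((min_le_left _ _).trans hμ) fun q hq => hl q (by simp [hq])⟩
    have := hi_succ_le hμ (hl q (by simp))
    have := h.1
    omega

lemma Hist.succ {T : ℕ} {l : List Tup} (h : Hist T l) (ht : ∀ q ∈ l, q.time ≤ T)
    (hl : ∀ q ∈ l, ∀ x ∈ q.abs, x.2 ≤ T) : Hist (T + 1) l := by
  induction l with
  | nil => trivial
  | cons q l ih =>
    exact ⟨h.1.succ (ht q (by simp)) fun q hq => hl q (by simp [hq]),
      ih h.2 (fun q hq => ht q (by simp [hq])) fun q hq => hl q (by simp [hq])⟩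

lemma Valid.succ {T : ℕ} {l : List Tup} (h : Valid T l) : Valid (T + 1) l where
  sorted := h.sorted
  cap t ht := (h.cap t ht).trans (by omega)
  dom := h.dom
  lev t ht x hx := level_succ_time (h.abs_time_le ht hx) (h.time_le ht) (h.lev t ht x hx)
  times x hx := (h.times x hx).trans (by omega)
  jump := h.jump
  hist := h.hist.succ (fun _ hq => h.time_le hq) fun _ hq _ hx => h.abs_time_le hq hx

/-! #### Merging -/

/-- The condition under which the tuples `R`, which come directly after the tuples `A`, may be
merged into the next tuple `k`. -/
structure MergeOK (T : ℕ) (A R : List (ℕ × ℕ)) (k : ℕ × ℕ) : Prop where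
  ne : R ≠ []
  le : ∀ r ∈ R, level T r.2 ≤ level T k.2
  left : ∀ z ∈ A.getLast?, ∀ r ∈ R, level T r.2 ≤ level T z.2
  -- This is `cap` for the merged tuple; the `+ 1` is there because the first component of a code
  -- also counts the stored value.
  fits : (R.map Prod.fst).sum + k.1 + k.2 ≤ T + 1

/-- Merge the tuples `R` into the tuple `k`. -/
def Tup.absorb (k : Tup) (R : List Tup) : Tup := { k with abs := allItems R ++ k.abs }

lemma sum_code_fst (R : List Tup) :
    ((R.map Tup.code).map Prod.fst).sum = (allItems R).length := by
  induction R with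
  | nil => rfl
  | cons t R ih =>
    rw [List.map_cons, List.map_cons, List.sum_cons, ih, allItems_cons, List.length_append]
    rfl

lemma code_absorb (k : Tup) (R : List Tup) :
    (k.absorb R).code = (((R.map Tup.code).map Prod.fst).sum + k.code.1, k.code.2) := by
  rw [sum_code_fst]; simp [Tup.code, Tup.absorb, add_assoc]

lemma items_absorb_perm (k : Tup) (R : List Tup) :
    (k.absorb R).items.Perm (allItems R ++ k.items) := by
  simp only [Tup.items, Tup.absorb]
  exact List.perm_middle.symm

lemma allItems_merge_perm (A R C : List Tup) (k : Tup) :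
    (allItems (A ++ k.absorb R :: C)).Perm (allItems (A ++ R ++ k :: C)) := by
  simp only [allItems_append, allItems_cons, List.append_assoc]
  refine List.Perm.append_left _ ?_
  rw [← List.append_assoc (allItems R)]
  exact (items_absorb_perm k R).append_right _

/-- Merging moves numbers to the right, but past no surviving tuple: those before `R` keep the same
numbers on their right, and so does `k`. -/
lemma jump_merge {A R C : List Tup} {k : Tup} (h : Jump (A ++ R ++ k :: C)) :
    Jump (A ++ k.absorb R :: C) := by
  induction A with
  | nil =>
    have := jump_append_right (l := R) (l' := k :: C) h
    exact ⟨this.1, this.2⟩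
  | cons t A ih =>
    exact ⟨((allItems_merge_perm A R C k).countP_eq _).le.trans h.1, ih h.2⟩

/-- By `hR`, nothing in `R` has a higher level than the running minimum in front of `R`. Hence the
absorbed items do not count as high for `k`, and deleting `R` does not lower the level of the
minimum seen by later tuples. -/
lemma good_merge {T p μ : ℕ} {A R C : List Tup} {k : Tup} (h : Good T p μ (A ++ R ++ k :: C))
    (hR : ∀ r ∈ R, level T r.time ≤ level T (minTime μ A))
    (hlev : ∀ r ∈ R, ∀ x ∈ r.abs, level T x.2 ≤ level T r.time) :
    Good T p μ (A ++ k.absorb R :: C) := by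
  rw [List.append_assoc, good_append, good_append] at h
  rw [good_append]
  obtain ⟨h1, -, h2, h3⟩ := h
  have hm : level T (minTime (minTime μ A) R) ≤ level T (minTime μ A) :=
    level_minTime_le.2 ⟨le_rfl, hR⟩
  refine ⟨h1, ?_, h3.mono ?_⟩
  · have h0 : hi T (minTime μ A) (k.absorb R) = hi T (minTime μ A) k := by
      simp only [hi, Tup.absorb, List.countP_append, Nat.add_eq_right, List.countP_eq_zero]
      intro x hx
      obtain ⟨t, ht, rfl | hx⟩ := mem_allItems.1 hx
      · simpa using hR t ht
      · simpa using (hlev t ht x hx).trans (hR t ht)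
    have := hi_anti hm k
    change _ ∨ _ + k.time ≤ p
    rw [h0]
    omega
  · change _ ≤ level T (min _ k.time)
    rw [level_min, level_min]
    exact max_le_max hm le_rfl

/-- The condition on the left neighbour of `R` suffices for all tuples further left, because the
level of an earliest time is the largest level in between. -/
lemma hist_merge {T : ℕ} {A R C : List Tup} {k : Tup} (h : Hist T (A ++ R ++ k :: C))
    (hA : ∀ z ∈ A.getLast?, ∀ r ∈ R, level T r.time ≤ level T z.time)
    (hlev : ∀ r ∈ R, ∀ x ∈ r.abs, level T x.2 ≤ level T r.time) :
    Hist T (A ++ k.absorb R :: C) := by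
  induction A with
  | nil =>
    have := hist_append_right (l := R) (l' := k :: C) h
    exact ⟨this.1, this.2⟩
  | cons t A ih =>
    refine ⟨good_merge h.1 ?_ hlev, ih h.2 ?_⟩
    · intro r hr
      rcases List.eq_nil_or_concat A with rfl | ⟨A', z, rfl⟩
      · exact hA t (by simp) r hr
      · refine (hA z (by simp [List.getLast?_cons]) r hr).trans ?_
        exact (level_minTime_le.1 le_rfl).2 z (by simp)
    · intro z hz
      refine hA z ?_
      cases A with
      | nil => simp at hz
      | cons _ _ => simpa [List.getLast?_cons_cons] using hz

lemma Valid.merge {T : ℕ} {A R C : List Tup} {k : Tup} (h : Valid T (A ++ R ++ k :: C))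
    (hm : MergeOK T (A.map Tup.code) (R.map Tup.code) k.code) :
    Valid T (A ++ k.absorb R :: C) := by
  have hs := h.sorted
  have hRk : ∀ r ∈ R, r.val ≤ k.val := by
    rw [List.pairwise_append] at hs
    exact fun r hr => hs.2.2 r (by simp [hr]) k (by simp)
  have hle : ∀ r ∈ R, level T r.time ≤ level T k.time := fun r hr =>
    hm.le r.code (List.mem_map_of_mem hr)
  have hf := hm.fits
  rw [sum_code_fst] at hf
  simp only [Tup.code] at hf
  have hmem : ∀ t ∈ A ++ k.absorb R :: C, t = k.absorb R ∨ t ∈ A ++ R ++ k :: C := by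
    intro t ht; simp at ht ⊢; tauto
  constructor
  · have hsub : (A ++ k :: C).Sublist (A ++ R ++ k :: C) :=
      (List.sublist_append_left A R).append_right _
    have := hs.sublist hsub
    rw [List.pairwise_append] at this ⊢
    refine ⟨this.1, List.pairwise_cons.2 (List.pairwise_cons.1 this.2.1), ?_⟩
    intro a ha b hb
    rcases List.mem_cons.1 hb with rfl | hb
    · exact this.2.2 a ha k (by simp)
    · exact this.2.2 a ha b (by simp [hb])
  · intro t ht
    rcases hmem t ht with rfl | ht
    · simp only [Tup.absorb, List.length_append]; omega
    · exact h.cap t ht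
  · intro t ht x hx
    rcases hmem t ht with rfl | ht
    · rcases List.mem_append.1 hx with hx | hx
      · obtain ⟨t, ht, rfl | hx⟩ := mem_allItems.1 hx
        · exact hRk t ht
        · exact (h.dom t (by simp [ht]) x hx).trans (hRk t ht)
      · exact h.dom k (by simp) x hx
    · exact h.dom t ht x hx
  · intro t ht x hx
    rcases hmem t ht with rfl | ht
    · rcases List.mem_append.1 hx with hx | hx
      · obtain ⟨t, ht, rfl | hx⟩ := mem_allItems.1 hx
        · exact hle t ht
        · exact (h.lev t (by simp [ht]) x hx).trans (hle t ht)
      · exact h.lev k (by simp) x hx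
    · exact h.lev t ht x hx
  · intro x hx
    exact h.times x ((allItems_merge_perm A R C k).mem_iff.1 hx)
  · exact jump_merge h.jump
  · refine hist_merge h.hist ?_ fun r hr => h.lev r (by simp [hr])
    intro z hz r hr
    exact hm.left z.code (by simp only [List.getLast?_map, Option.mem_def] at hz ⊢; simp [hz])
      r.code (List.mem_map_of_mem hr)

/-! #### Size -/

/-- No merging is possible. -/
def Stuck (T : ℕ) (l : List (ℕ × ℕ)) : Prop :=
  ∀ A R k C, l = A ++ R ++ k :: C → ¬ MergeOK T A R k

/-- The number of items of level at most `a`. -/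
def low (T a : ℕ) (l : List Tup) : ℕ := (allItems l).countP fun x => level T x.2 ≤ a

lemma low_append (T a : ℕ) (l l' : List Tup) : low T a (l ++ l') = low T a l + low T a l' := by
  simp [low, List.countP_append]

lemma low_cons (T a : ℕ) (t : Tup) (l : List Tup) :
    low T a (t :: l) = low T a [t] + low T a l := low_append T a [t] l

lemma Valid.low_eq_length {T a : ℕ} {l R : List Tup} (h : Valid T l) (hR : ∀ r ∈ R, r ∈ l)
    (ha : ∀ r ∈ R, level T r.time ≤ a) : low T a R = (allItems R).length := by
  rw [low, List.countP_eq_length]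
  intro x hx
  obtain ⟨t, ht, rfl | hx⟩ := mem_allItems.1 hx
  · simpa using ha t ht
  · simpa using (h.lev t (hR t ht) x hx).trans (ha t ht)

/-- Merging `R ++ i :: S` into `k` meets every condition of `MergeOK` except possibly `fits`, so
`fits` fails. All items of `R ++ i :: S` are low, and `Hist` controls the items of `k` that are not;
what remains of the overflow is an age of at least `2 ^ a / 4` that must be filled by low items. -/
lemma pow_le_of_stuck {T a : ℕ} (ha : 0 < a) {A R S C : List Tup} {i k : Tup}
    (h : Valid T (A ++ (R ++ i :: S) ++ k :: C))
    (hst : Stuck T ((A ++ (R ++ i :: S) ++ k :: C).map Tup.code))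
    (hA : ∀ z ∈ A.getLast?, a ≤ level T z.time) (hR : ∀ r ∈ R, level T r.time < a)
    (hS : ∀ r ∈ S, level T r.time < a) (hi' : level T i.time = a) (hk : a ≤ level T k.time) :
    2 ^ a ≤ 4 * (low T a (R ++ i :: S) + low T a [k]) := by
  have hle : ∀ r ∈ R ++ i :: S, level T r.time ≤ a := by
    intro r hr
    rcases List.mem_append.1 hr with hr | hr
    · exact (hR r hr).le
    rcases List.mem_cons.1 hr with rfl | hr
    · exact hi'.le
    · exact (hS r hr).le
  have hnot := hst (A.map Tup.code) ((R ++ i :: S).map Tup.code) k.code (C.map Tup.code)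
    (by simp)
  have hf : ¬ (((R ++ i :: S).map Tup.code).map Prod.fst).sum + k.code.1 + k.code.2 ≤ T + 1 := by
    intro hf
    refine hnot ⟨by simp, ?_, ?_, hf⟩
    · intro r hr
      obtain ⟨r, hr', rfl⟩ := List.mem_map.1 hr
      exact (hle r hr').trans hk
    · intro z hz r hr
      obtain ⟨r, hr', rfl⟩ := List.mem_map.1 hr
      simp only [List.getLast?_map, Option.mem_def, Option.map_eq_some_iff] at hz
      obtain ⟨z, hz, rfl⟩ := hz
      exact (hle r hr').trans (hA z hz)
  rw [sum_code_fst] at hf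
  simp only [Tup.code] at hf
  have hlow : low T a (R ++ i :: S) = (allItems (R ++ i :: S)).length :=
    h.low_eq_length (fun r hr => by simp at hr ⊢; tauto) hle
  have hhist : Hist T (i :: (S ++ k :: C)) := by
    refine hist_append_right (l := A ++ R) ?_
    simpa using h.hist
  have hg := (good_append.1 hhist.1).2.1
  -- The tuples of `S` have levels below that of `i`, so being high with respect to this minimum
  -- means having level above `a`.
  have hmt : level T (minTime i.time S) = a := by
    refine le_antisymm (level_minTime_le.2 ⟨hi'.le, fun t ht => (hS t ht).le⟩) ?_
    rw [← hi']
    exact (level_minTime_le.1 le_rfl).1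
  have hlk : k.abs.length ≤ low T a [k] + hi T (minTime i.time S) k := by
    rw [hi, hmt]
    have e := List.length_eq_countP_add_countP (fun x : ℝ × ℕ => decide (level T x.2 ≤ a))
      (l := k.abs)
    have e1 : k.abs.countP (fun x => decide (level T x.2 ≤ a)) ≤ low T a [k] := by
      simp only [low, allItems_cons, allItems_nil, List.append_nil, Tup.items, List.countP_cons]
      omega
    have e2 : k.abs.countP (fun x => decide ¬ (decide (level T x.2 ≤ a) = true))
        = k.abs.countP (fun x => decide (a < level T x.2)) := by
      congr 1; ext x; simp
    rw [e2] at e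
    omega
  rw [hlow] at *
  -- Without high items in `k`, the overflow exceeds the age of `k`; otherwise the high items fit
  -- below `i.time`, and the overflow exceeds the age of `i`.
  rcases hg with hg | hg
  · have := pow_lt_of_le_level ha hk
    omega
  · have := pow_lt_of_le_level ha hi'.ge
    omega

lemma exists_first {T a : ℕ} (l : List Tup) :
    (∀ t ∈ l, level T t.time < a) ∨
      ∃ R p l', l = R ++ p :: l' ∧ (∀ r ∈ R, level T r.time < a) ∧ a ≤ level T p.time := by
  induction l with
  | nil => simp
  | cons t l ih =>
    by_cases ht : a ≤ level T t.time
    · exact .inr ⟨[], t, l, rfl, by simp, ht⟩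
    · rcases ih with h | ⟨R, p, l', rfl, hR, hp⟩
      · left; simpa using ⟨not_le.1 ht, h⟩
      · exact .inr ⟨t :: R, p, l', rfl, by simpa using ⟨not_le.1 ht, hR⟩, hp⟩

/-- The number of tuples of level `a`. -/
def atLevel (T a : ℕ) (l : List Tup) : ℕ := l.countP fun t => level T t.time = a

lemma atLevel_eq_zero {T a : ℕ} {l : List Tup} (h : ∀ t ∈ l, level T t.time < a) :
    atLevel T a l = 0 := by
  rw [atLevel, List.countP_eq_zero]
  intro t ht
  simpa using (h t ht).ne

/-- The list is cut at the tuples of level at least `a`. A tuple `p` of level exactly `a` is charged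
to the two runs around it, to itself and to the next cut tuple by `pow_le_of_stuck`. Each item is
charged at most twice, those up to the first cut only once; the last cut tuple has nothing to merge
into and accounts for the extra `2 ^ a`. -/
lemma atLevel_le_aux {T a : ℕ} (ha : 0 < a) (n : ℕ) {A R l' : List Tup} {p : Tup}
    (hn : l'.length ≤ n) (h : Valid T (A ++ R ++ p :: l'))
    (hst : Stuck T ((A ++ R ++ p :: l').map Tup.code))
    (hA : ∀ z ∈ A.getLast?, a ≤ level T z.time) (hR : ∀ r ∈ R, level T r.time < a)
    (hp : a ≤ level T p.time) :
    atLevel T a (p :: l') * 2 ^ a ≤ 4 * (low T a (R ++ [p]) + 2 * low T a l') + 2 ^ a := by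
  induction n generalizing A R l' p with
  | zero =>
    obtain rfl : l' = [] := List.length_eq_zero_iff.1 (by omega)
    have : atLevel T a [p] ≤ 1 := List.countP_le_length
    nlinarith [Nat.zero_le (low T a (R ++ [p])), Nat.zero_le (low T a []),
      Nat.mul_le_mul_right (2 ^ a) this]
  | succ n ih =>
    rcases exists_first (T := T) (a := a) l' with h0 | ⟨R', p', l'', rfl, hR', hp'⟩
    · have h1 : atLevel T a (p :: l') ≤ 1 := by
        have := atLevel_eq_zero h0
        simp only [atLevel, List.countP_cons] at this ⊢
        rw [this]; split <;> omega
      nlinarith [Nat.zero_le (low T a (R ++ [p])), Nat.zero_le (low T a l'),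
        Nat.mul_le_mul_right (2 ^ a) h1]
    · have hlist : A ++ R ++ p :: (R' ++ p' :: l'') = (A ++ R ++ [p]) ++ R' ++ p' :: l'' := by
        simp
      have IH := ih (A := A ++ R ++ [p]) (R := R') (l' := l'') (p := p')
        (by simp at hn; omega) (hlist ▸ h) (hlist ▸ hst) (by simpa using hp) hR' hp'
      have hz : atLevel T a R' = 0 := atLevel_eq_zero hR'
      have hcount : atLevel T a (p :: (R' ++ p' :: l'')) =
          (if level T p.time = a then 1 else 0) + atLevel T a (p' :: l'') := by
        simp only [atLevel, List.countP_cons, List.countP_append] at hz ⊢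
        rw [hz]; simp; omega
      rw [hcount]
      have e1 := low_append T a R [p]
      have e2 := low_append T a R' [p']
      have e3 := low_append T a R' (p' :: l'')
      have e4 := low_cons T a p' l''
      split_ifs with hpa
      · have hlist2 : A ++ R ++ p :: (R' ++ p' :: l'') = A ++ (R ++ p :: R') ++ p' :: l'' := by
          simp
        have := pow_le_of_stuck ha (hlist2 ▸ h) (hlist2 ▸ hst) hA hR hR' hpa hp'
        have e5 := low_append T a R (p :: R')
        have e6 := low_cons T a p R'
        rw [add_mul, one_mul]
        omega
      · rw [zero_add]
        omega

lemma atLevel_le {T a : ℕ} (ha : 0 < a) {l : List Tup} (h : Valid T l)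
    (hst : Stuck T (l.map Tup.code)) :
    atLevel T a l * 2 ^ a ≤ 8 * low T a l + 2 ^ a := by
  rcases exists_first (T := T) (a := a) l with h0 | ⟨R, p, l', rfl, hR, hp⟩
  · rw [atLevel_eq_zero h0]; simp
  · have := atLevel_le_aux ha l'.length (A := []) le_rfl h hst (by simp) hR hp
    have hz : atLevel T a R = 0 := atLevel_eq_zero hR
    have hcount : atLevel T a (R ++ p :: l') = atLevel T a (p :: l') := by
      simp only [atLevel, List.countP_append] at hz ⊢
      omega
    have e1 := low_append T a R [p]
    have e3 := low_append T a R (p :: l')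
    have e4 := low_cons T a p l'
    rw [hcount]
    omega

lemma countP_le_sum_fiber {α : Type*} (l : List α) (f : α → ℕ) (p : α → Bool) (s : Finset ℕ)
    (hp : ∀ x ∈ l, p x = true → f x ∈ s) :
    l.countP p ≤ ∑ t ∈ s, l.countP (fun x => f x = t) := by
  induction l with
  | nil => simp
  | cons x l ih =>
    have := ih fun y hy => hp y (by simp [hy])
    simp only [List.countP_cons, Finset.sum_add_distrib]
    by_cases hx : p x = true
    · have hm := hp x (by simp) hx
      have : 1 ≤ ∑ t ∈ s, (if decide (f x = t) = true then 1 else 0) := by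
        simp [Finset.sum_ite_eq, hm]
      simp only [hx, if_true]
      omega
    · simp only [hx]
      simp; omega

/-- Level at most `a` confines the arrival to the last `2 ^ a` time steps. -/
lemma low_le {T a B : ℕ} {l : List Tup} (hT : ∀ x ∈ allItems l, x.2 < T)
    (hB : ∀ t, (allItems l).countP (fun x => x.2 = t) ≤ B) : low T a l ≤ 2 ^ a * B := by
  refine (countP_le_sum_fiber _ Prod.snd _ (Finset.Ico (T - 2 ^ a) T) ?_).trans ?_
  · intro x hx h
    have h' : level T x.2 ≤ a := by simpa using h
    have := lt_of_level_le h'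
    have := hT x hx
    rw [Finset.mem_Ico]; omega
  · refine (Finset.sum_le_card_nsmul _ _ B fun t _ => hB t).trans ?_
    rw [Nat.card_Ico, smul_eq_mul]
    exact Nat.mul_le_mul_right _ tsub_tsub_le

/-- A summary in which no merging is possible is short. -/
lemma length_le_of_stuck {T B : ℕ} {l : List Tup} (h : Valid T l)
    (hst : Stuck T (l.map Tup.code)) (hT : ∀ x ∈ allItems l, x.2 < T)
    (hB : ∀ t, (allItems l).countP (fun x => x.2 = t) ≤ B) :
    l.length ≤ (Nat.log 2 T + 1) * (8 * B + 1) := by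
  have h1 : l.length ≤ ∑ a ∈ Finset.Icc 1 (Nat.log 2 T + 1), atLevel T a l := by
    rw [← congrFun List.countP_true l]
    refine countP_le_sum_fiber l (fun t => level T t.time) _ _ fun t ht _ => ?_
    -- No item carries the current time, so level `0` is empty and only positive levels have to be
    -- counted.
    have h0 : t.time < T := hT (t.val, t.time) (mem_allItems.2 ⟨t, ht, .inl rfl⟩)
    exact Finset.mem_Icc.2 ⟨level_pos h0, level_le_log T t.time⟩
  refine h1.trans ((Finset.sum_le_card_nsmul _ _ (8 * B + 1) fun a ha => ?_).trans ?_)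
  · have h2 := atLevel_le (Finset.mem_Icc.1 ha).1 h hst
    have h3 := low_le (a := a) hT hB
    have hp : 0 < 2 ^ a := by positivity
    refine Nat.le_of_mul_le_mul_right (c := 2 ^ a) ?_ hp
    nlinarith
  · simp

/-! ### Packing multisets of numbers -/

/-- The numbers in `s` can be packed into `m` bins of capacity one. -/
def Packs (s : Multiset ℝ) (m : ℕ) : Prop :=
  ∃ P : Fin m → Multiset ℝ, ∑ b, P b = s ∧ ∀ b, (P b).sum ≤ 1

lemma Packs.add {s t : Multiset ℝ} {m n : ℕ} (hs : Packs s m) (ht : Packs t n) :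
    Packs (s + t) (m + n) := by
  obtain ⟨P, rfl, hP⟩ := hs
  obtain ⟨Q, rfl, hQ⟩ := ht
  refine ⟨Fin.append P Q, ?_, ?_⟩
  · simp [Fin.sum_univ_add]
  · intro b
    refine Fin.addCases (fun i => ?_) (fun i => ?_) b
    · simpa using hP i
    · simpa using hQ i

lemma packs_zero (m : ℕ) : Packs 0 m := ⟨fun _ => 0, by simp, by simp⟩

lemma Packs.mono {s : Multiset ℝ} {m n : ℕ} (hs : Packs s m) (h : m ≤ n) : Packs s n := by
  obtain ⟨k, rfl⟩ := Nat.exists_eq_add_of_le h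
  simpa using hs.add (packs_zero k)

lemma Packs.sum_le {s : Multiset ℝ} {m : ℕ} (hs : Packs s m) : s.sum ≤ m := by
  obtain ⟨P, rfl, hP⟩ := hs
  rw [Multiset.sum_sum]
  calc ∑ b, (P b).sum ≤ ∑ _b : Fin m, (1 : ℝ) := Finset.sum_le_sum fun b _ => hP b
    _ = m := by simp

lemma packs_card {s : Multiset ℝ} (hs : ∀ x ∈ s, x ≤ 1) : Packs s s.card := by
  induction s using Multiset.induction with
  | empty => exact packs_zero _
  | cons x s ih =>
    have h1 : Packs {x} 1 := ⟨fun _ => {x}, by simp, fun _ => by simpa using hs x (by simp)⟩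
    have := (ih fun y hy => hs y (by simp [hy])).add h1
    rw [Multiset.card_cons]
    rwa [add_comm, Multiset.singleton_add] at this

lemma sum_update_cons {m : ℕ} (P : Fin m → Multiset ℝ) (b : Fin m) (x : ℝ) :
    ∑ c, Function.update P b (x ::ₘ P b) c = x ::ₘ ∑ c, P c := by
  rw [Finset.sum_update_of_mem (Finset.mem_univ b), ← Finset.add_sum_erase _ P (Finset.mem_univ b),
    Finset.sdiff_singleton_eq_erase]
  simp

/-- Small numbers can be added to a packing as long as the total volume is small. -/
lemma Packs.greedy {s t : Multiset ℝ} {m : ℕ} {e : ℝ} (hs : Packs s m)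
    (ht : ∀ x ∈ t, 0 ≤ x ∧ x ≤ e) (hV : s.sum + t.sum ≤ m * (1 - e)) (hm : t ≠ 0 → 0 < m) :
    Packs (s + t) m := by
  induction t using Multiset.induction with
  | empty => simpa using hs
  | cons x t ih =>
    have hx := ht x (by simp)
    have hm' := hm (by simp)
    rw [Multiset.sum_cons] at hV
    obtain ⟨P, hP, hP1⟩ := ih (fun y hy => ht y (by simp [hy])) (by linarith) fun _ => hm'
    obtain ⟨b, hb⟩ : ∃ b, (P b).sum ≤ 1 - e := by
      by_contra! hcon
      have : Nonempty (Fin m) := ⟨⟨0, hm'⟩⟩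
      have h1 : ∑ _b : Fin m, (1 - e) < ∑ b, (P b).sum :=
        Finset.sum_lt_sum_of_nonempty Finset.univ_nonempty fun b _ => hcon b
      rw [← Multiset.sum_sum, hP, Multiset.sum_add] at h1
      simp at h1
      linarith
    refine ⟨Function.update P b (x ::ₘ P b), ?_, fun c => ?_⟩
    · rw [sum_update_cons, hP, Multiset.add_cons]
    · by_cases hc : c = b
      · subst hc
        rw [Function.update_self, Multiset.sum_cons]; linarith
      · rw [Function.update_of_ne hc]; exact hP1 c

/-- `s` is dominated by `t`: above every threshold, `t` has at least as many elements. -/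
def Dominated (s t : Multiset ℝ) : Prop :=
  ∀ y, s.countP (fun x => y ≤ x) ≤ t.countP (fun x => y ≤ x)

lemma Dominated.refl (s : Multiset ℝ) : Dominated s s := fun _ => le_rfl

lemma Dominated.add {s t s' t' : Multiset ℝ} (h : Dominated s t) (h' : Dominated s' t') :
    Dominated (s + s') (t + t') := fun y => by
  rw [Multiset.countP_add, Multiset.countP_add]
  exact add_le_add (h y) (h' y)

/-- A largest `x` in `s` takes the place of some `y ≥ x` in a bin of `P`. Removing both preserves
domination: thresholds up to `x` lose one element on each side, and above `x` nothing is left of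
`s`. -/
lemma Dominated.exists_packing {s : Multiset ℝ} {m : ℕ} {P : Fin m → Multiset ℝ}
    (h : Dominated s (∑ b, P b)) (hP : ∀ b, ∀ x ∈ P b, 0 ≤ x) :
    ∃ Q : Fin m → Multiset ℝ, ∑ b, Q b = s ∧ ∀ b, (Q b).sum ≤ (P b).sum := by
  induction hn : s.card generalizing s P with
  | zero =>
    rw [Multiset.card_eq_zero] at hn
    exact ⟨fun _ => 0, by simp [hn], fun b => by simpa using Multiset.sum_nonneg (hP b)⟩
  | succ n ih =>
    have hs0 : s.toFinset.Nonempty := by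
      rw [Multiset.toFinset_nonempty]; rintro rfl; simp at hn
    obtain ⟨x, hx, hmax⟩ := s.toFinset.exists_max_image id hs0
    simp only [Multiset.mem_toFinset, id] at hx hmax
    obtain ⟨s', rfl⟩ := Multiset.exists_cons_of_mem hx
    have hpos : 0 < (∑ b, P b).countP (fun z => x ≤ z) := by
      refine lt_of_lt_of_le ?_ (h x)
      rw [Multiset.countP_cons_of_pos _ (le_refl x)]; omega
    obtain ⟨y, hy, hxy⟩ := Multiset.countP_pos.1 hpos
    obtain ⟨b, -, hb⟩ := Multiset.mem_sum.1 hy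
    obtain ⟨p, hp⟩ := Multiset.exists_cons_of_mem hb
    set P' := Function.update P b p with hP'
    have hPP : P = Function.update P' b (y ::ₘ P' b) := by
      funext c
      by_cases hc : c = b
      · subst hc; simp [hP', hp]
      · simp [hP', Function.update_of_ne hc]
    have hsum : ∑ c, P c = y ::ₘ ∑ c, P' c := by
      conv_lhs => rw [hPP]
      exact sum_update_cons P' b y
    have hdom : Dominated s' (∑ c, P' c) := by
      intro z
      have hz := h z
      rw [hsum] at hz
      by_cases hzx : z ≤ x
      · rw [Multiset.countP_cons_of_pos _ hzx, Multiset.countP_cons_of_pos _ (hzx.trans hxy)] at hz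
        exact Nat.le_of_succ_le_succ hz
      · rw [Multiset.countP_eq_zero.2]
        · omega
        · intro w hw hzw
          exact hzx (hzw.trans (hmax w (by simp [hw])))
    obtain ⟨Q, hQ, hQP⟩ := ih hdom (fun c w hw => by
      by_cases hc : c = b
      · subst hc
        refine hP c w ?_
        rw [hp]; simp only [hP', Function.update_self] at hw; simp [hw]
      · refine hP c w ?_
        simpa [hP', Function.update_of_ne hc] using hw) (by simpa using hn)
    refine ⟨Function.update Q b (x ::ₘ Q b), by rw [sum_update_cons, hQ], fun c => ?_⟩
    have := hQP c
    by_cases hc : c = b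
    · subst hc
      simp only [hP', Function.update_self] at this
      rw [Function.update_self, hp, Multiset.sum_cons, Multiset.sum_cons]
      linarith
    · rw [Function.update_of_ne hc]
      simpa [hP', Function.update_of_ne hc] using this

lemma Dominated.packs {s t : Multiset ℝ} {m : ℕ} (h : Dominated s t) (ht : ∀ x ∈ t, 0 ≤ x)
    (hm : Packs t m) : Packs s m := by
  obtain ⟨P, rfl, hP⟩ := hm
  obtain ⟨Q, hQ, hQP⟩ := h.exists_packing fun b x hx =>
    ht x (Multiset.mem_sum.2 ⟨b, Finset.mem_univ b, hx⟩)
  exact ⟨Q, hQ, fun b => (hQP b).trans (hP b)⟩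

lemma Dominated.sum_le {s t : Multiset ℝ} (h : Dominated s t) (ht : ∀ x ∈ t, 0 ≤ x) :
    s.sum ≤ t.sum := by
  obtain ⟨Q, hQ, hQP⟩ := Dominated.exists_packing (m := 1) (P := fun _ => t) (by simpa using h)
    fun _ => ht
  simpa [← hQ] using hQP 0

lemma card_le_two_mul_sum {s : Multiset ℝ} (hs : ∀ x ∈ s, 1 / 2 ≤ x) :
    (s.card : ℝ) ≤ 2 * s.sum := by
  induction s using Multiset.induction with
  | empty => simp
  | cons x s ih =>
    have := ih fun y hy => hs y (by simp [hy])
    have := hs x (by simp)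
    simp only [Multiset.card_cons, Multiset.sum_cons, Nat.cast_add, Nat.cast_one]
    linarith

/-- Numbers of total volume `V` can be packed into `2 * V + 1` bins. -/
lemma exists_packs {s : Multiset ℝ} (hs : ∀ x ∈ s, 0 ≤ x ∧ x ≤ 1) :
    ∃ m : ℕ, Packs s m ∧ (m : ℝ) ≤ 2 * s.sum + 1 := by
  set a := s.filter (fun x => 1 / 2 ≤ x) with ha
  set b := s.filter (fun x => ¬ 1 / 2 ≤ x) with hb
  have hab : a + b = s := Multiset.filter_add_not _ _
  have hmem : ∀ x ∈ b, 0 ≤ x ∧ x ≤ 1 / 2 := fun x hx => by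
    rw [hb, Multiset.mem_filter] at hx
    exact ⟨(hs x hx.1).1, (not_le.1 hx.2).le⟩
  have hb0 : 0 ≤ b.sum := Multiset.sum_nonneg fun x hx => (hmem x hx).1
  have h1 : Packs a a.card := packs_card fun x hx => (hs x (Multiset.mem_of_mem_filter hx)).2
  have h2 := card_le_two_mul_sum (s := a) fun x hx => (Multiset.mem_filter.1 hx).2
  have hsum : s.sum = a.sum + b.sum := by rw [← hab, Multiset.sum_add]
  -- If the remaining numbers are all zero, the ceiling used below would supply no bin, so they get
  -- the additional one.
  by_cases hbz : b.sum = 0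
  · have hall : ∀ x ∈ b, x = 0 := by
      intro x hx
      refine le_antisymm ?_ (hmem x hx).1
      rw [← hbz]
      exact Multiset.single_le_sum (fun y hy => (hmem y hy).1) x hx
    have h3 : Packs b 1 := by
      refine ⟨fun _ => b, by simp, fun _ => by rw [hbz]; norm_num⟩
    refine ⟨a.card + 1, hab ▸ h1.add h3, ?_⟩
    push_cast; linarith
  · have hbpos : 0 < b.sum := lt_of_le_of_ne hb0 (Ne.symm hbz)
    have h3 : Packs (0 + b) ⌈2 * b.sum⌉₊ := by
      refine (packs_zero _).greedy hmem ?_ fun _ => Nat.ceil_pos.2 (by linarith)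
      have := Nat.le_ceil (2 * b.sum)
      simp only [Multiset.sum_zero]; linarith
    rw [zero_add] at h3
    refine ⟨a.card + ⌈2 * b.sum⌉₊, hab ▸ h1.add h3, ?_⟩
    have := Nat.ceil_lt_add_one (show 0 ≤ 2 * b.sum by linarith)
    push_cast; linarith

/-! ### Vectors and their norms -/

/-- The norms of the vectors in a list. -/
noncomputable def norms {d : ℕ} (I : List (Fin d → ℝ)) : List ℝ := I.map fun v => ‖v‖

/-- Passes from multisets to indices. Vectors of equal norm are interchangeable, so each vector may
claim any copy of its norm. -/
lemma exists_assignment {d m : ℕ} (I : List (Fin d → ℝ)) (P : Fin m → Multiset ℝ)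
    (h : ∑ b, P b = (norms I : Multiset ℝ)) :
    ∃ f : Fin I.length → Fin m, ∀ b, ∑ i with f i = b, ‖I.get i‖ = (P b).sum := by
  induction I generalizing P with
  | nil =>
    refine ⟨fun i => i.elim0, fun b => ?_⟩
    have : P b ≤ ∑ b, P b := Finset.single_le_sum (fun _ _ => Multiset.zero_le _) (Finset.mem_univ b)
    rw [h] at this
    have : P b = 0 := by simpa [norms] using this
    simp [this]
  | cons v I ih =>
    have hv : ‖v‖ ∈ ∑ b, P b := by rw [h]; simp [norms]
    obtain ⟨b, -, hb⟩ := Multiset.mem_sum.1 hv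
    obtain ⟨p, hp⟩ := Multiset.exists_cons_of_mem hb
    have hPP : P = Function.update (Function.update P b p) b
        (‖v‖ ::ₘ Function.update P b p b) := by
      funext c
      by_cases hc : c = b
      · subst hc; simp [hp]
      · simp [Function.update_of_ne hc]
    have hsum : ∑ c, P c = ‖v‖ ::ₘ ∑ c, Function.update P b p c := by
      conv_lhs => rw [hPP]
      exact sum_update_cons _ b _
    obtain ⟨f, hf⟩ := ih (Function.update P b p) (by
      rw [hsum] at h
      simpa [norms, ← Multiset.cons_coe] using h)
    refine ⟨Fin.cons b f, fun c => ?_⟩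
    have hc := hf c
    rw [Finset.sum_filter] at hc ⊢
    have e : ∑ i : Fin (v :: I).length, (if (Fin.cons b f : Fin (I.length + 1) → Fin m) i = c
        then ‖(v :: I).get i‖ else 0) = (if b = c then ‖v‖ else 0) +
        ∑ i : Fin I.length, (if f i = c then ‖I.get i‖ else 0) := by
      exact Fin.sum_univ_succ _
    rw [e, hc]
    by_cases hbc : b = c
    · subst hbc; simp [hp]
    · simp [hbc, Function.update_of_ne (Ne.symm hbc)]

lemma canPack_of_packs {d m : ℕ} {I : List (Fin d → ℝ)}
    (h : Packs (norms I : Multiset ℝ) m) : CanPack I m := by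
  obtain ⟨P, hP, hP1⟩ := h
  obtain ⟨f, hf⟩ := exists_assignment I P hP
  exact ⟨f, fun b => (norm_sum_le _ _).trans ((hf b).le.trans (hP1 b))⟩

lemma sum_singleton_norms {d : ℕ} (I : List (Fin d → ℝ)) :
    ∑ i : Fin I.length, ({‖I.get i‖} : Multiset ℝ) = (norms I : Multiset ℝ) := by
  induction I with
  | nil => rfl
  | cons v I ih =>
    have e : ∑ i : Fin (v :: I).length, ({‖(v :: I).get i‖} : Multiset ℝ) =
        {‖v‖} + ∑ i : Fin I.length, ({‖I.get i‖} : Multiset ℝ) := Fin.sum_univ_succ _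
    rw [e, ih]
    simp [norms, ← Multiset.cons_coe]

lemma exists_norm_eq {d : ℕ} (hd : 0 < d) {v : Fin d → ℝ} (hv : IsItem v) :
    ∃ k, ‖v‖ = v k ∧ ∀ j, v j ≤ v k := by
  have : Nonempty (Fin d) := ⟨⟨0, hd⟩⟩
  obtain ⟨k, -, hk⟩ := Finset.univ.exists_max_image v Finset.univ_nonempty
  refine ⟨k, le_antisymm ?_ ?_, fun j => hk j (Finset.mem_univ j)⟩
  · refine (pi_norm_le_iff_of_nonneg (hv k).1).2 fun j => ?_
    rw [Real.norm_of_nonneg (hv j).1]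
    exact hk j (Finset.mem_univ j)
  · exact (le_abs_self _).trans (norm_le_pi_norm v k)

/-- A packing of vectors into `m` bins gives a packing of their norms into `d * m` bins. -/
lemma packs_norms {d m : ℕ} (hd : 0 < d) {I : List (Fin d → ℝ)} (hI : ∀ v ∈ I, IsItem v)
    (h : CanPack I m) : Packs (norms I : Multiset ℝ) (d * m) := by
  obtain ⟨f, hf⟩ := h
  have hk : ∀ i : Fin I.length, ∃ k, ‖I.get i‖ = I.get i k := fun i => by
    obtain ⟨k, hk, -⟩ := exists_norm_eq hd (hI _ (List.get_mem I i))
    exact ⟨k, hk⟩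
  choose k hk using hk
  -- Each bin is split by the coordinate attaining the norm; within the part belonging to `k0`,
  -- norms are `k0`-th coordinates, whose sum is at most one.
  set F : Fin I.length → Fin (d * m) := fun i => finProdFinEquiv (k i, f i)
  refine ⟨fun c => ∑ i with F i = c, {‖I.get i‖}, ?_, fun c => ?_⟩
  · rw [Finset.sum_fiberwise, sum_singleton_norms]
  · obtain ⟨⟨k0, b⟩, rfl⟩ := finProdFinEquiv.surjective c
    rw [Multiset.sum_sum]
    simp only [Multiset.sum_singleton]
    have hnn : ∀ i, 0 ≤ I.get i k0 := fun i => (hI _ (List.get_mem I i) k0).1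
    calc ∑ i with F i = finProdFinEquiv (k0, b), ‖I.get i‖
        = ∑ i with F i = finProdFinEquiv (k0, b), I.get i k0 := by
          refine Finset.sum_congr rfl fun i hi => ?_
          have : k i = k0 := by
            have := finProdFinEquiv.injective (Finset.mem_filter.1 hi).2
            exact congrArg Prod.fst this
          rw [hk, this]
      _ ≤ ∑ i with f i = b, I.get i k0 := by
          refine Finset.sum_le_sum_of_subset_of_nonneg (fun i hi => ?_) fun i _ _ => hnn i
          have := finProdFinEquiv.injective (Finset.mem_filter.1 hi).2
          simpa using congrArg Prod.snd this
      _ = (∑ i with f i = b, I.get i) k0 := by rw [Finset.sum_apply]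
      _ ≤ ‖∑ i with f i = b, I.get i‖ :=
          (le_abs_self _).trans (norm_le_pi_norm (∑ i with f i = b, I.get i) k0)
      _ ≤ 1 := hf b

lemma canPack_OPT {d : ℕ} {I : List (Fin d → ℝ)} (hI : ∀ v ∈ I, IsItem v) :
    CanPack I (OPT I) := by
  refine Nat.sInf_mem (s := {m | CanPack I m}) ⟨(norms I : Multiset ℝ).card,
    canPack_of_packs (packs_card fun x hx => ?_)⟩
  simp only [norms, Multiset.mem_coe, List.mem_map] at hx
  obtain ⟨v, hv, rfl⟩ := hx
  exact (pi_norm_le_iff_of_nonneg zero_le_one).2 fun k => by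
    rw [Real.norm_of_nonneg (hI v hv k).1]; exact (hI v hv k).2

lemma OPT_le_of_packs {d m : ℕ} {I : List (Fin d → ℝ)}
    (h : Packs (norms I : Multiset ℝ) m) : OPT I ≤ m := Nat.sInf_le (canPack_of_packs h)

lemma norms_scalarInstance {d : ℕ} (I : List (Fin d → ℝ)) :
    norms (scalarInstance I) = norms I := by
  simp [norms, scalarInstance, Function.comp_def]

lemma OPT_scalarInstance_le {d : ℕ} (hd : 0 < d) {I : List (Fin d → ℝ)}
    (hI : ∀ v ∈ I, IsItem v) : OPT (scalarInstance I) ≤ d * OPT I := by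
  refine OPT_le_of_packs ?_
  rw [norms_scalarInstance]
  exact packs_norms hd hI (canPack_OPT hI)

/-! ### The schedule of one size class -/

/-- The number of items of class `j` that arrive at time `T`. -/
def blockSize (r m j T : ℕ) : ℕ := if T < 2 ^ j * 2 ^ m then 2 ^ r else 2 ^ m

/-- The number of items of class `j` that arrive before time `T`. -/
def arrived (r m j T : ℕ) : ℕ := 2 ^ r * min T (2 ^ j * 2 ^ m) + 2 ^ m * (T - 2 ^ j * 2 ^ m)

lemma blockSize_pos (r m j T : ℕ) : 0 < blockSize r m j T := by
  unfold blockSize; split <;> positivity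

lemma blockSize_mono {r m : ℕ} (h : r ≤ m) (j : ℕ) {T T' : ℕ} (hT : T ≤ T') :
    blockSize r m j T ≤ blockSize r m j T' := by
  have : 2 ^ r ≤ 2 ^ m := Nat.pow_le_pow_right (by norm_num) h
  unfold blockSize; split_ifs <;> omega

lemma arrived_succ (r m j T : ℕ) :
    arrived r m j (T + 1) = arrived r m j T + blockSize r m j T := by
  unfold arrived blockSize
  split_ifs with h
  · rw [min_eq_left (by omega), min_eq_left (by omega), Nat.sub_eq_zero_of_le (by omega),
      Nat.sub_eq_zero_of_le (by omega)]
    ring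
  · rw [min_eq_right (by omega), min_eq_right (by omega), Nat.succ_sub (by omega)]
    rw [Nat.succ_eq_add_one]; ring

/-- The size of a summary after merging at time `T`. -/
def sizeBound (r m j T : ℕ) : ℕ := (Nat.log 2 T + 1) * (8 * blockSize r m j T + 1)

lemma sizeBound_mono {r m : ℕ} (h : r ≤ m) (j : ℕ) {T T' : ℕ} (hT : T ≤ T') :
    sizeBound r m j T ≤ sizeBound r m j T' := by
  have := blockSize_mono h j hT
  have := Nat.log_mono_right (b := 2) hT
  exact Nat.mul_le_mul (by omega) (by omega)

/-- What is stored about a size class besides the numbers: the time, the number of items that have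
arrived at this time, and the codes of the tuples. -/
structure Cls where
  time : ℕ
  cnt : ℕ
  tl : List (ℕ × ℕ)

/-- The invariants of a size class; `mg` says that merging is under way. -/
structure ClsInv (r m j : ℕ) (c : Cls) (g : List Tup) (mg : Prop) : Prop where
  code : c.tl = g.map Tup.code
  valid : Valid c.time g
  card : (allItems g).length = arrived r m j c.time + c.cnt
  cnt_lt : c.cnt < blockSize r m j c.time
  fiber : ∀ t, (allItems g).countP (fun x => x.2 = t) ≤ blockSize r m j t
  fiber_time : (allItems g).countP (fun x => x.2 = c.time) = c.cnt
  range : ∀ x ∈ allItems g, (1 / 2 : ℝ) ^ (j + 1) < x.1 ∧ x.1 ≤ (1 / 2 : ℝ) ^ j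
  len : ¬ mg → g.length ≤ sizeBound r m j c.time + c.cnt
  len_mg : mg → g.length ≤ sizeBound r m j c.time + blockSize r m j c.time
  cnt_mg : mg → c.cnt = 0

lemma clsInv_empty (r m j : ℕ) : ClsInv r m j ⟨0, 0, []⟩ [] False where
  code := rfl
  valid := valid_nil 0
  card := by simp [arrived]
  cnt_lt := blockSize_pos _ _ _ _
  fiber := by simp
  fiber_time := by simp
  range := by simp
  len := by simp
  len_mg := by simp
  cnt_mg := by simp

/-- The class after the insertion of a new tuple at position `pos`. -/
def Cls.insert (r m j : ℕ) (c : Cls) (pos : ℕ) : Cls :=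
  if c.cnt + 1 < blockSize r m j c.time then
    ⟨c.time, c.cnt + 1, c.tl.take pos ++ (1, c.time) :: c.tl.drop pos⟩
  else ⟨c.time + 1, 0, c.tl.take pos ++ (1, c.time) :: c.tl.drop pos⟩

lemma allItems_insert_perm (A C : List Tup) (v : ℝ) (T : ℕ) :
    (allItems (A ++ Tup.new v T :: C)).Perm ((v, T) :: allItems (A ++ C)) := by
  simp only [allItems_append, allItems_cons, Tup.items, Tup.new, List.cons_append,
    List.nil_append]
  exact List.perm_middle

lemma ClsInv.insert {r m j : ℕ} (hrm : r ≤ m) {c : Cls} {A C : List Tup} {v : ℝ}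
    (h : ClsInv r m j c (A ++ C) False) (hA : ∀ t ∈ A, t.val < v) (hC : ∀ t ∈ C, v ≤ t.val)
    (hv : (1 / 2 : ℝ) ^ (j + 1) < v ∧ v ≤ (1 / 2 : ℝ) ^ j) :
    ClsInv r m j (c.insert r m j A.length) (A ++ Tup.new v c.time :: C)
      (¬ c.cnt + 1 < blockSize r m j c.time) := by
  have hperm := allItems_insert_perm A C v c.time
  have hval := h.valid.insert hA hC
  have hcode : c.tl.take A.length ++ (1, c.time) :: c.tl.drop A.length =
      (A ++ Tup.new v c.time :: C).map Tup.code := by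
    rw [h.code]
    simp [Tup.new, Tup.code]
  have hlen := h.len not_false
  have hcnt := h.cnt_lt
  have hlen' : (A ++ Tup.new v c.time :: C).length = (A ++ C).length + 1 := by
    simp; omega
  have hfib : ∀ t, (allItems (A ++ Tup.new v c.time :: C)).countP (fun x => x.2 = t) =
      (allItems (A ++ C)).countP (fun x => x.2 = t) + if c.time = t then 1 else 0 := by
    intro t
    rw [hperm.countP_eq, List.countP_cons]
    simp
  have hft := h.fiber_time
  have hfiber : ∀ t, (allItems (A ++ Tup.new v c.time :: C)).countP (fun x => x.2 = t) ≤
      blockSize r m j t := by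
    intro t
    rw [hfib]
    split_ifs with ht
    · subst ht; omega
    · simpa using h.fiber t
  have hrange : ∀ x ∈ allItems (A ++ Tup.new v c.time :: C),
      (1 / 2 : ℝ) ^ (j + 1) < x.1 ∧ x.1 ≤ (1 / 2 : ℝ) ^ j := by
    intro x hx
    rcases List.mem_cons.1 (hperm.mem_iff.1 hx) with rfl | hx
    · exact hv
    · exact h.range x hx
  have hcard := hperm.length_eq
  rw [List.length_cons, h.card] at hcard
  unfold Cls.insert
  split_ifs with hb
  · exact
    { code := hcode
      valid := hval
      card := by rw [hcard, add_assoc]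
      cnt_lt := hb
      fiber := hfiber
      fiber_time := (hfib c.time).trans (by rw [hft, if_pos rfl])
      range := hrange
      len := fun _ => by rw [hlen', ← add_assoc]; exact Nat.succ_le_succ hlen
      len_mg := fun h => absurd hb h
      cnt_mg := fun h => absurd hb h }
  · have hbe : c.cnt + 1 = blockSize r m j c.time := by omega
    exact
    { code := hcode
      valid := hval.succ
      card := by rw [hcard, arrived_succ, ← hbe]; rfl
      cnt_lt := blockSize_pos _ _ _ _
      fiber := hfiber
      fiber_time := by
        rw [List.countP_eq_zero]
        intro x hx
        have := hval.times x hx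
        simp only [decide_eq_true_eq]
        omega
      range := hrange
      len := fun h => absurd hb h
      -- A full block adds `blockSize` tuples to a list within `sizeBound`, and both quantities are
      -- monotone in time.
      len_mg := fun _ => by
        have h1 := blockSize_mono hrm j (Nat.le_succ c.time)
        have h2 := sizeBound_mono hrm j (Nat.le_succ c.time)
        simp only [Nat.succ_eq_add_one] at h1 h2
        show _ ≤ sizeBound r m j (c.time + 1) + blockSize r m j (c.time + 1)
        omega
      cnt_mg := fun _ => rfl }

lemma ClsInv.merge {r m j : ℕ} {c : Cls} {A R C : List Tup} {k : Tup}
    (h : ClsInv r m j c (A ++ R ++ k :: C) True)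
    (hm : MergeOK c.time (A.map Tup.code) (R.map Tup.code) k.code) :
    ClsInv r m j ⟨c.time, c.cnt, (A ++ k.absorb R :: C).map Tup.code⟩
      (A ++ k.absorb R :: C) True := by
  have hperm := allItems_merge_perm A R C k
  exact
  { code := rfl
    valid := h.valid.merge hm
    card := hperm.length_eq.trans h.card
    cnt_lt := h.cnt_lt
    fiber := fun t => (hperm.countP_eq _).le.trans (h.fiber t)
    fiber_time := (hperm.countP_eq _).trans h.fiber_time
    range := fun x hx => h.range x (hperm.mem_iff.1 hx)
    len := fun h => absurd trivial h
    len_mg := fun _ => by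
      refine le_trans ?_ (h.len_mg trivial)
      simp
    cnt_mg := fun _ => h.cnt_mg trivial }

/-- Merging takes place at the start of a block, when `cnt = 0`: no item carries the current time
yet, as `length_le_of_stuck` requires. -/
lemma ClsInv.finish {r m j : ℕ} (hrm : r ≤ m) {c : Cls} {g : List Tup}
    (h : ClsInv r m j c g True) (hst : Stuck c.time c.tl) : ClsInv r m j c g False := by
  have h0 := h.cnt_mg trivial
  have hT : ∀ x ∈ allItems g, x.2 < c.time := by
    intro x hx
    refine lt_of_le_of_ne (h.valid.times x hx) fun he => ?_
    have := h.fiber_time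
    rw [h0, List.countP_eq_zero] at this
    exact this x hx (by simpa using he)
  refine { h with len := fun _ => ?_, len_mg := False.elim, cnt_mg := False.elim }
  refine (length_le_of_stuck (B := blockSize r m j c.time) h.valid (h.code ▸ hst) hT
    fun t => ?_).trans (Nat.le_add_right _ _)
  rcases le_total t c.time with ht | ht
  · exact (h.fiber t).trans (blockSize_mono hrm j ht)
  · rw [List.countP_eq_zero.2]
    · exact Nat.zero_le _
    · intro x hx
      have := hT x hx
      simp only [decide_eq_true_eq]; omega

/-! ### The integer words -/

/-- The program counter, with the indices in use. -/
inductive PC (d m : ℕ) where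
  | init
  | scan (k best : Fin d)
  | classify (best : Fin d) (j : Fin m)
  | small (best : Fin d)
  | locate (best : Fin d) (j : Fin m) (pos : ℕ)
  | insert (best : Fin d) (j : Fin m) (pos : ℕ)
  | merge (j : Fin m)
  | done

/-- What the integer words hold. -/
structure Meta (d m : ℕ) where
  pc : PC d m
  cls : Fin m → Cls

def PC.enc {d m : ℕ} : PC d m → List ℕ
  | init => [0, 0, 0, 0]
  | scan k best => [1, k, best, 0]
  | classify best j => [2, best, j, 0]
  | small best => [3, best, 0, 0]
  | locate best j pos => [4, best, j, pos]
  | insert best j pos => [5, best, j, pos]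
  | merge j => [6, j, 0, 0]
  | done => [7, 0, 0, 0]

def encPairs (l : List (ℕ × ℕ)) : List ℕ := l.flatMap fun p => [p.1, p.2]

def Cls.enc (c : Cls) : List ℕ := c.time :: c.cnt :: c.tl.length :: encPairs c.tl

/-- The integer words. -/
def Meta.enc {d m : ℕ} (M : Meta d m) : List ℕ :=
  M.pc.enc ++ (List.ofFn M.cls).flatMap Cls.enc

lemma PC.enc_length {d m : ℕ} (p : PC d m) : p.enc.length = 4 := by cases p <;> rfl

lemma PC.enc_injective {d m : ℕ} : Function.Injective (PC.enc (d := d) (m := m)) := by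
  intro p q h
  cases p <;> cases q <;> simp_all [PC.enc, Fin.ext_iff]

lemma encPairs_append_inj {l l' : List (ℕ × ℕ)} {x y : List ℕ} (hl : l.length = l'.length)
    (h : encPairs l ++ x = encPairs l' ++ y) : l = l' ∧ x = y := by
  induction l generalizing l' with
  | nil =>
    obtain rfl : l' = [] := List.length_eq_zero_iff.1 hl.symm
    exact ⟨rfl, h⟩
  | cons p l ih =>
    cases l' with
    | nil => simp at hl
    | cons p' l' =>
      simp only [encPairs, List.flatMap_cons, List.cons_append, List.nil_append,
        List.cons.injEq] at h
      obtain ⟨rfl, rfl⟩ := ih (by simpa using hl) h.2.2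
      exact ⟨by rw [Prod.ext h.1 h.2.1], rfl⟩

lemma Cls.enc_append_inj {c c' : Cls} {x y : List ℕ} (h : c.enc ++ x = c'.enc ++ y) :
    c = c' ∧ x = y := by
  simp only [Cls.enc, List.cons_append, List.cons.injEq] at h
  obtain ⟨h1, h2, h3, h4⟩ := h
  obtain ⟨h5, rfl⟩ := encPairs_append_inj h3 h4
  cases c; cases c'; simp_all

lemma flatMap_enc_inj {l l' : List Cls} (hl : l.length = l'.length)
    (h : l.flatMap Cls.enc = l'.flatMap Cls.enc) : l = l' := by
  induction l generalizing l' with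
  | nil => exact (List.length_eq_zero_iff.1 hl.symm).symm
  | cons c l ih =>
    cases l' with
    | nil => simp at hl
    | cons c' l' =>
      simp only [List.flatMap_cons] at h
      obtain ⟨rfl, h'⟩ := Cls.enc_append_inj h
      rw [ih (by simpa using hl) h']

/-- The code can be read from left to right: the program counter is padded to four words, and each
class announces the number of its tuples. So the integer words determine the whole control state. -/
lemma Meta.enc_injective {d m : ℕ} : Function.Injective (Meta.enc (d := d) (m := m)) := by
  rintro ⟨p, c⟩ ⟨p', c'⟩ h
  obtain ⟨h1, h2⟩ := List.append_inj h (by simp [PC.enc_length])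
  have h1 := PC.enc_injective h1
  have h2 := List.ofFn_injective (flatMap_enc_inj (by simp) h2)
  simp_all

/-! ### The number words -/

/-- The total number of tuples before class `j`. -/
def offset {m : ℕ} (cls : Fin m → Cls) (j : Fin m) : ℕ :=
  (((List.ofFn cls).take j).map fun c => c.tl.length).sum

/-- The total number of tuples. -/
def tuples {m : ℕ} (cls : Fin m → Cls) : ℕ := ((List.ofFn cls).map fun c => c.tl.length).sum

/-- The numbers stored for all size classes. -/
def flat {m : ℕ} (g : Fin m → List Tup) : List ℝ := (List.ofFn fun j => (g j).map Tup.val).flatten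

lemma ofFn_update {α : Type*} {m : ℕ} (f : Fin m → α) (j : Fin m) (a : α) :
    List.ofFn (Function.update f j a) =
      (List.ofFn f).take j ++ a :: (List.ofFn f).drop (j + 1) := by
  have hset := List.set_eq_take_append_cons_drop (l := List.ofFn f) (i := j) (a := a)
  rw [if_pos (by simp)] at hset
  rw [← hset]
  refine List.ext_getElem (by simp) fun i h1 h2 => ?_
  simp only [List.getElem_ofFn, List.getElem_set]
  by_cases hij : (j : ℕ) = i
  · have : (⟨i, by simpa using h1⟩ : Fin m) = j := Fin.ext hij.symm
    simp [hij, this]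
  · have : (⟨i, by simpa using h1⟩ : Fin m) ≠ j := fun h => hij (by rw [← h])
    simp [hij, Function.update_of_ne this]

/-- The values of class `j` form one contiguous segment beginning at its offset, and `X`, `Y` do not
depend on `l`. Editing a class thus amounts to `take` and `drop` on the number words. -/
lemma flat_update {m : ℕ} (g : Fin m → List Tup) (cls : Fin m → Cls)
    (h : ∀ i, (cls i).tl = (g i).map Tup.code) (j : Fin m) :
    ∃ X Y, X.length = offset cls j ∧
      ∀ l, flat (Function.update g j l) = X ++ (l.map Tup.val ++ Y) := by
  refine ⟨((List.ofFn fun j => (g j).map Tup.val).take j).flatten,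
    ((List.ofFn fun j => (g j).map Tup.val).drop (j + 1)).flatten, ?_, fun l => ?_⟩
  · have : cls = fun i => ⟨(cls i).time, (cls i).cnt, (g i).map Tup.code⟩ := by
      funext i; rw [← h i]
    rw [this]
    simp only [offset, List.length_flatten, List.map_take, List.map_ofFn, Function.comp_def,
      List.length_map]
  · have : (fun i => (Function.update g j l i).map Tup.val) =
        Function.update (fun i => (g i).map Tup.val) j (l.map Tup.val) := by
      funext i
      by_cases hi : i = j
      · subst hi; simp
      · simp [Function.update_of_ne hi]
    rw [flat, this, ofFn_update]
    simp

lemma length_flat {m : ℕ} (g : Fin m → List Tup) (cls : Fin m → Cls)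
    (h : ∀ i, (cls i).tl = (g i).map Tup.code) : (flat g).length = tuples cls := by
  simp [flat, tuples, List.length_flatten, List.map_ofFn, Function.comp_def, h]

/-- The linear combinations that just copy the first `n` number words. -/
def copyWords (d n : ℕ) : List (LinComb d) := (List.range n).map fun i => [(1, .word i)]

lemma eval_copyWords {d : ℕ} (nums : List ℝ) (v : Fin d → ℝ) :
    (copyWords d nums.length).map (fun e => e.eval nums v) = nums := by
  refine List.ext_getElem (by simp [copyWords]) fun i h1 h2 => ?_
  simp [copyWords, LinComb.eval, Source.eval, h2]

lemma eval_coord {d : ℕ} (nums : List ℝ) (v : Fin d → ℝ) (k : Fin d) :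
    LinComb.eval nums v [(1, .coord k)] = v k := by
  simp [LinComb.eval, Source.eval]

/-! ### The algorithm -/

section Program

variable {d m : ℕ}

/-- The program counter after comparing coordinate `k` with the largest coordinate so far. -/
def PC.afterScan [NeZero m] (k best : Fin d) : PC d m :=
  if h : k + 1 < d then .scan ⟨k + 1, h⟩ best else .classify best 0

/-- The program counter when the size is at most `(1 / 2) ^ (j + 1)`. -/
def PC.afterClassify (best : Fin d) (j : Fin m) : PC d m :=
  if h : j + 1 < m then .classify best ⟨j + 1, h⟩ else .small best

/-- The program counter after an insertion into class `j`. -/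
def PC.afterInsert (r : ℕ) (cls : Fin m → Cls) (j : Fin m) : PC d m :=
  if (cls j).cnt + 1 < blockSize r m j (cls j).time then .done else .merge j

/-- Parts `A`, `R`, `k`, `C` of a list of tuples in which `R` can be merged into `k`. -/
def Mergeable (c : Cls) (x : List (ℕ × ℕ) × List (ℕ × ℕ) × (ℕ × ℕ) × List (ℕ × ℕ)) : Prop :=
  c.tl = x.1 ++ x.2.1 ++ x.2.2.1 :: x.2.2.2 ∧ MergeOK c.time x.1 x.2.1 x.2.2.1

/-- The class after a merging. -/
def Cls.merge (c : Cls) (x : List (ℕ × ℕ) × List (ℕ × ℕ) × (ℕ × ℕ) × List (ℕ × ℕ)) : Cls :=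
  ⟨c.time, c.cnt, x.1 ++ ((x.2.1.map Prod.fst).sum + x.2.2.1.1, x.2.2.1.2) :: x.2.2.2⟩

open Classical in
/-- The instruction for given contents of the integer words. -/
noncomputable def program [NeZero d] [NeZero m] (r : ℕ) (M : Meta d m) : Instr d :=
  -- An assignment rewrites all number words, so the unchanged ones are copied. The additional word,
  -- at position `0`, is the running sum of the small items.
  let words := copyWords d (tuples M.cls + 1)
  match M.pc with
  | .init => .assign [[]] (Meta.enc (d := d) (m := m) ⟨.scan 0 0, M.cls⟩)
  | .scan k best => .compare (.coord k) (.coord best)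
      (Meta.enc (d := d) (m := m) ⟨.afterScan k best, M.cls⟩) (Meta.enc (d := d) (m := m) ⟨.afterScan k k, M.cls⟩)
  | .classify best j => .compareConst (.coord best) ((1 / 2) ^ ((j : ℕ) + 1))
      (Meta.enc (d := d) (m := m) ⟨.afterClassify best j, M.cls⟩) (Meta.enc (d := d) (m := m) ⟨.locate best j 0, M.cls⟩)
  | .small best => .assign ([(1, .word 0), (1, .coord best)] :: words.drop 1)
      (Meta.enc (d := d) (m := m) ⟨.done, M.cls⟩)
  | .locate best j pos =>
      if pos < (M.cls j).tl.length then
        .compare (.coord best) (.word (1 + offset M.cls j + pos))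
          (Meta.enc (d := d) (m := m) ⟨.insert best j pos, M.cls⟩) (Meta.enc (d := d) (m := m) ⟨.locate best j (pos + 1), M.cls⟩)
      -- Past the last tuple there is nothing to compare with; this comparison is just a jump.
      else .compare (.coord best) (.coord best)
          (Meta.enc (d := d) (m := m) ⟨.insert best j pos, M.cls⟩) (Meta.enc (d := d) (m := m) ⟨.insert best j pos, M.cls⟩)
  | .insert best j pos =>
      .assign (words.take (1 + offset M.cls j + pos) ++
          [(1, .coord best)] :: words.drop (1 + offset M.cls j + pos))
        (Meta.enc (d := d) (m := m) ⟨.afterInsert r M.cls j,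
          Function.update M.cls j ((M.cls j).insert r m j pos)⟩)
  | .merge j =>
      if h : ∃ x, Mergeable (M.cls j) x then
        .assign (words.take (1 + offset M.cls j + h.choose.1.length) ++
            words.drop (1 + offset M.cls j + h.choose.1.length + h.choose.2.1.length))
          (Meta.enc (d := d) (m := m) ⟨.merge j, Function.update M.cls j ((M.cls j).merge h.choose)⟩)
      else .next (Meta.enc (d := d) (m := m) ⟨.scan 0 0, M.cls⟩)
  | .done => .next (Meta.enc (d := d) (m := m) ⟨.scan 0 0, M.cls⟩)

/-- The numbers that represent the items that are not small, with multiplicities. -/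
def rounded (M : Meta d m) (nums : List ℝ) : Multiset ℝ :=
  (List.zipWith (fun c v => List.replicate c.1 v) (List.ofFn fun j => (M.cls j).tl).flatten
    nums.tail).flatten

/-- The answer. -/
noncomputable def answer (M : Meta d m) (nums : List ℝ) : ℕ :=
  -- The additional bin matters when `n = 0` is accepted although there are small items, all of size
  -- zero.
  1 + sInf {n : ℕ | Packs (rounded M nums) n ∧
    (rounded M nums).sum + nums.headD 0 ≤ n * (1 - (1 / 2 : ℝ) ^ m)}

open Classical in
/-- The streaming algorithm. -/
noncomputable def algorithm (d m r : ℕ) [NeZero d] [NeZero m] : StreamingAlgorithm d where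
  init := Meta.enc (d := d) (m := m) ⟨.init, fun _ => ⟨0, 0, []⟩⟩
  instr l := if h : ∃ M : Meta d m, M.enc = l then program r h.choose else .next []
  output s := if h : ∃ M : Meta d m, M.enc = s.ints then answer h.choose s.nums else 0

lemma algorithm_instr [NeZero d] [NeZero m] (r : ℕ) (M : Meta d m) :
    (algorithm d m r).instr M.enc = program r M := by
  have h : ∃ M' : Meta d m, M'.enc = M.enc := ⟨M, rfl⟩
  have he : h.choose = M := Meta.enc_injective h.choose_spec
  simp only [algorithm]
  rw [dif_pos h, he]

lemma algorithm_output [NeZero d] [NeZero m] (r : ℕ) (M : Meta d m) {s : Memory}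
    (hs : s.ints = M.enc) : (algorithm d m r).output s = answer M s.nums := by
  have h : ∃ M' : Meta d m, M'.enc = s.ints := ⟨M, hs.symm⟩
  have he : h.choose = M := Meta.enc_injective (h.choose_spec.trans hs)
  simp only [algorithm]
  rw [dif_pos h, he]

/-! ### The invariant -/

/-- The numbers that a family of summaries stands for. -/
def itemsOf (g : Fin m → List Tup) : Multiset ℝ :=
  ∑ j, ((allItems (g j)).map Prod.fst : Multiset ℝ)

lemma itemsOf_update_cons (g : Fin m → List Tup) (j : Fin m) (l : List Tup) (x : ℝ × ℕ)
    (h : (allItems l).Perm (x :: allItems (g j))) :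
    itemsOf (Function.update g j l) = x.1 ::ₘ itemsOf g := by
  have e : (fun i => (((allItems (Function.update g j l i)).map Prod.fst : List ℝ) : Multiset ℝ)) =
      Function.update (fun i => (((allItems (g i)).map Prod.fst : List ℝ) : Multiset ℝ)) j
        (x.1 ::ₘ (((allItems (g j)).map Prod.fst : List ℝ) : Multiset ℝ)) := by
    funext i
    by_cases hi : i = j
    · subst hi
      simp only [Function.update_self]
      rw [Multiset.cons_coe, Multiset.coe_eq_coe]
      exact h.map Prod.fst
    · simp [Function.update_of_ne hi]
  rw [itemsOf, e, sum_update_cons]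
  rfl

lemma itemsOf_update_perm (g : Fin m → List Tup) (j : Fin m) (l : List Tup)
    (h : (allItems l).Perm (allItems (g j))) :
    itemsOf (Function.update g j l) = itemsOf g := by
  refine Finset.sum_congr rfl fun i _ => ?_
  by_cases hi : i = j
  · subst hi
    rw [Function.update_self, Multiset.coe_eq_coe]
    exact h.map Prod.fst
  · rw [Function.update_of_ne hi]

/-- The summaries `g` and the list `small` describe the items `H` seen so far; merging is under way
in the class `mg`. -/
structure Data (r : ℕ) (H : List (Fin d → ℝ)) (cls : Fin m → Cls) (g : Fin m → List Tup)
    (small : List ℝ) (mg : Option (Fin m)) : Prop where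
  cls : ∀ j : Fin m, ClsInv r m j (cls j) (g j) (mg = some j)
  items : (small : Multiset ℝ) + itemsOf g = (norms H : Multiset ℝ)
  small_le : ∀ x ∈ small, 0 ≤ x ∧ x ≤ (1 / 2 : ℝ) ^ m

/-- The class in which merging is under way. -/
def PC.merging : PC d m → Option (Fin m)
  | .merge j => some j
  | _ => none

/-- The coordinate `k` of `v` is largest. -/
def IsMax (v : Fin d → ℝ) (k : Fin d) : Prop := ∀ i, v i ≤ v k

/-- What is known about the number words and the current item. -/
def PC.Facts (I H rest : List (Fin d → ℝ)) (g : Fin m → List Tup) (small nums : List ℝ) :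
    PC d m → Prop
  | .init => nums = [] ∧ (∀ j, g j = []) ∧ small = [] ∧ I = H ++ rest
  | .scan k best => nums = small.sum :: flat g ∧ I = H ++ rest ∧
      ∀ v ∈ rest.head?, ∀ i < k, v i ≤ v best
  | .classify best j => nums = small.sum :: flat g ∧ I = H ++ rest ∧
      ∃ v ∈ rest.head?, IsMax v best ∧ v best ≤ (1 / 2 : ℝ) ^ (j : ℕ)
  | .small best => nums = small.sum :: flat g ∧ I = H ++ rest ∧
      ∃ v ∈ rest.head?, IsMax v best ∧ v best ≤ (1 / 2 : ℝ) ^ m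
  | .locate best j pos => nums = small.sum :: flat g ∧ I = H ++ rest ∧
      ∃ v ∈ rest.head?, IsMax v best ∧
        ((1 / 2 : ℝ) ^ ((j : ℕ) + 1) < v best ∧ v best ≤ (1 / 2 : ℝ) ^ (j : ℕ)) ∧
        ∃ A C, g j = A ++ C ∧ A.length = pos ∧ ∀ t ∈ A, t.val < v best
  | .insert best j pos => nums = small.sum :: flat g ∧ I = H ++ rest ∧
      ∃ v ∈ rest.head?, IsMax v best ∧
        ((1 / 2 : ℝ) ^ ((j : ℕ) + 1) < v best ∧ v best ≤ (1 / 2 : ℝ) ^ (j : ℕ)) ∧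
        ∃ A C, g j = A ++ C ∧ A.length = pos ∧ (∀ t ∈ A, t.val < v best) ∧
          ∀ t ∈ C, v best ≤ t.val
  -- In this state and the next, the current item already belongs to `H` but has not been dropped
  -- from the stream.
  | .merge _ => nums = small.sum :: flat g ∧ I = H ++ rest.tail ∧ rest ≠ []
  | .done => nums = small.sum :: flat g ∧ I = H ++ rest.tail ∧ rest ≠ []

/-- The invariant of the computation on the input `I`. -/
def Inv (r : ℕ) (I : List (Fin d → ℝ)) (M : Meta d m) (s : Memory) (rest : List (Fin d → ℝ)) :
    Prop :=
  s.ints = M.enc ∧ ∃ g small H, Data r H M.cls g small M.pc.merging ∧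
    M.pc.Facts I H rest g small s.nums

/-- A measure that decreases until the current item has been processed. -/
def Meta.rank (M : Meta d m) : ℕ ×ₗ ℕ :=
  match M.pc with
  | .init => toLex (8, 0)
  | .scan k _ => toLex (7, d - k)
  | .classify _ j => toLex (6, m - j)
  | .small _ => toLex (5, 0)
  | .locate _ j pos => toLex (5, (M.cls j).tl.length - pos)
  | .insert _ _ _ => toLex (4, 0)
  | .merge j => toLex (3, (M.cls j).tl.length)
  | .done => toLex (2, 0)

lemma rank_lt_of_fst {M M' : Meta d m} (h : (ofLex M.rank).1 < (ofLex M'.rank).1) :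
    M.rank < M'.rank := Prod.Lex.lt_iff.2 (.inl h)

lemma rank_lt_of_snd {M M' : Meta d m} (h1 : (ofLex M.rank).1 = (ofLex M'.rank).1)
    (h : (ofLex M.rank).2 < (ofLex M'.rank).2) :
    M.rank < M'.rank := Prod.Lex.lt_iff.2 (.inr ⟨h1, h⟩)

/-- The computation has made progress: it is at an earlier stage of a shorter stream, or at a later
stage of the same stream. -/
def Progress (M : Meta d m) (rest : List (Fin d → ℝ)) (M' : Meta d m)
    (rest' : List (Fin d → ℝ)) : Prop :=
  rest'.length < rest.length ∨ rest'.length = rest.length ∧ M'.rank < M.rank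

lemma ClsInv.congr {r j : ℕ} {c : Cls} {g : List Tup} {p q : Prop} (h : ClsInv r m j c g p)
    (hpq : p ↔ q) : ClsInv r m j c g q := propext hpq ▸ h

lemma norm_eq_of_isMax {v : Fin d → ℝ} {k : Fin d} (hv : IsItem v) (hk : IsMax v k) :
    ‖v‖ = v k := by
  obtain ⟨i, hi, -⟩ := exists_norm_eq (Nat.lt_of_le_of_lt (Nat.zero_le _) k.2) hv
  refine le_antisymm (hi.le.trans (hk i)) ?_
  exact (le_abs_self _).trans (norm_le_pi_norm v k)

lemma norms_append_singleton (H : List (Fin d → ℝ)) (v : Fin d → ℝ) :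
    (norms (H ++ [v]) : Multiset ℝ) = ‖v‖ ::ₘ (norms H : Multiset ℝ) := by
  simp [norms, ← Multiset.coe_add, add_comm, ← Multiset.singleton_add]

section Scan

variable [NeZero m] {I : List (Fin d → ℝ)} {v : Fin d → ℝ} {rest : List (Fin d → ℝ)}

lemma facts_afterScan {H : List (Fin d → ℝ)} {g : Fin m → List Tup} {small nums : List ℝ}
    (hI' : ∀ w ∈ I, IsItem w) {k best : Fin d}
    (hn : nums = small.sum :: flat g) (hI : I = H ++ v :: rest) (hk : ∀ i ≤ k, v i ≤ v best) :
    (PC.afterScan (m := m) k best).Facts I H (v :: rest) g small nums := by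
  unfold PC.afterScan
  split_ifs with h
  · refine ⟨hn, hI, ?_⟩
    rintro w hw i hi
    obtain rfl : v = w := by simpa using hw
    exact hk i (Fin.le_def.2 (Nat.lt_succ_iff.1 (Fin.lt_def.1 hi)))
  · refine ⟨hn, hI, v, rfl, fun i => hk i (Fin.le_def.2 (by omega)), ?_⟩
    simpa using (hI' v (by simp [hI]) best).2

lemma rank_afterScan (cls : Fin m → Cls) (k best best' : Fin d) :
    (⟨PC.afterScan k best', cls⟩ : Meta d m).rank < (⟨.scan k best, cls⟩ : Meta d m).rank := by
  unfold PC.afterScan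
  split_ifs with h
  · refine rank_lt_of_snd rfl ?_
    simp only [Meta.rank, ofLex_toLex]
    omega
  · exact rank_lt_of_fst (by simp [Meta.rank])

lemma merging_afterScan (k best : Fin d) :
    (PC.afterScan (m := m) k best).merging = none := by
  unfold PC.afterScan; split_ifs <;> rfl

end Scan

lemma Data.nums_length {r : ℕ} {H : List (Fin d → ℝ)} {cls : Fin m → Cls} {g : Fin m → List Tup}
    {small : List ℝ} {mg : Option (Fin m)} (hD : Data r H cls g small mg) (x : ℝ) :
    (x :: flat g).length = tuples cls + 1 := by
  rw [List.length_cons, length_flat g cls fun i => (hD.cls i).code]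

lemma nums_split {r : ℕ} {H : List (Fin d → ℝ)} {cls : Fin m → Cls} {g : Fin m → List Tup}
    {small : List ℝ} {mg : Option (Fin m)} (hD : Data r H cls g small mg) (j : Fin m) :
    ∃ X Y, X.length = 1 + offset cls j ∧ small.sum :: flat g = X ++ ((g j).map Tup.val ++ Y) ∧
      ∀ l, small.sum :: flat (Function.update g j l) = X ++ (l.map Tup.val ++ Y) := by
  obtain ⟨X, Y, hX, hXY⟩ := flat_update g cls (fun i => (hD.cls i).code) j
  refine ⟨small.sum :: X, Y, by rw [List.length_cons, hX, add_comm], ?_, fun l => by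
    rw [hXY]; rfl⟩
  have := hXY (g j)
  rw [Function.update_eq_self] at this
  rw [this]; rfl

/-! ### Every instruction preserves the invariant and makes progress -/

section Steps

variable [NeZero d] [NeZero m] {r : ℕ} {I : List (Fin d → ℝ)} {M : Meta d m} {s : Memory}
  {v : Fin d → ℝ} {rest : List (Fin d → ℝ)}

/-- A step leads to a configuration with the invariant, and makes progress. -/
def StepOK (r : ℕ) (I : List (Fin d → ℝ)) (M : Meta d m) (s : Memory) (v : Fin d → ℝ)
    (rest : List (Fin d → ℝ)) : Prop :=
  ∃ M' s' rest', (algorithm d m r).step (s, v :: rest) = some (s', rest') ∧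
    Inv r I M' s' rest' ∧ Progress M (v :: rest) M' rest'

lemma step_assign {es : List (LinComb d)} {ints : List ℕ} (hs : s.ints = M.enc)
    (h : program r M = .assign es ints) : (algorithm d m r).step (s, v :: rest) =
      some (⟨ints, es.map fun e => e.eval s.nums v⟩, v :: rest) := by
  simp only [StreamingAlgorithm.step, hs, algorithm_instr, h]

lemma step_next {ints : List ℕ} (hs : s.ints = M.enc)
    (h : program r M = .next ints) : (algorithm d m r).step (s, v :: rest) =
      some (⟨ints, s.nums⟩, rest) := by
  simp only [StreamingAlgorithm.step, hs, algorithm_instr, h]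

lemma step_compare_yes {a b : Source d} {yes no : List ℕ} (hs : s.ints = M.enc)
    (h : program r M = .compare a b yes no) (hab : a.eval s.nums v ≤ b.eval s.nums v) :
    (algorithm d m r).step (s, v :: rest) = some (⟨yes, s.nums⟩, v :: rest) := by
  simp only [StreamingAlgorithm.step, hs, algorithm_instr, h, if_pos hab]

lemma step_compare_no {a b : Source d} {yes no : List ℕ} (hs : s.ints = M.enc)
    (h : program r M = .compare a b yes no) (hab : ¬ a.eval s.nums v ≤ b.eval s.nums v) :
    (algorithm d m r).step (s, v :: rest) = some (⟨no, s.nums⟩, v :: rest) := by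
  simp only [StreamingAlgorithm.step, hs, algorithm_instr, h, if_neg hab]

lemma step_const_yes {a : Source d} {q : ℚ} {yes no : List ℕ} (hs : s.ints = M.enc)
    (h : program r M = .compareConst a q yes no) (hab : a.eval s.nums v ≤ (q : ℝ)) :
    (algorithm d m r).step (s, v :: rest) = some (⟨yes, s.nums⟩, v :: rest) := by
  simp only [StreamingAlgorithm.step, hs, algorithm_instr, h, if_pos hab]

lemma step_const_no {a : Source d} {q : ℚ} {yes no : List ℕ} (hs : s.ints = M.enc)
    (h : program r M = .compareConst a q yes no) (hab : ¬ a.eval s.nums v ≤ (q : ℝ)) :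
    (algorithm d m r).step (s, v :: rest) = some (⟨no, s.nums⟩, v :: rest) := by
  simp only [StreamingAlgorithm.step, hs, algorithm_instr, h, if_neg hab]

lemma stepOK_init (hinv : Inv r I M s (v :: rest)) (hpc : M.pc = .init) :
    StepOK r I M s v rest := by
  obtain ⟨pc, cls⟩ := M
  obtain rfl : pc = _ := hpc
  obtain ⟨hs, g, small, H, hD, hn, hg, hsm, hI⟩ := hinv
  refine ⟨⟨.scan 0 0, cls⟩, _, _, step_assign hs rfl, ⟨rfl, g, small, H, hD, ?_, hI, ?_⟩,
    .inr ⟨rfl, rank_lt_of_fst (by simp [Meta.rank])⟩⟩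
  · have : flat g = [] := by simp [flat, hg]
    simp [hsm, this, LinComb.eval]
  · simp

lemma stepOK_done (hinv : Inv r I M s (v :: rest)) (hpc : M.pc = .done) :
    StepOK r I M s v rest := by
  obtain ⟨pc, cls⟩ := M
  obtain rfl : pc = _ := hpc
  obtain ⟨hs, g, small, H, hD, hn, hI, -⟩ := hinv
  refine ⟨⟨.scan 0 0, cls⟩, _, _, step_next hs rfl, ⟨rfl, g, small, H, hD, hn, hI, ?_⟩,
    .inl (by simp)⟩
  simp

lemma stepOK_scan (hI' : ∀ w ∈ I, IsItem w) {k best : Fin d} (hinv : Inv r I M s (v :: rest))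
    (hpc : M.pc = .scan k best) : StepOK r I M s v rest := by
  obtain ⟨pc, cls⟩ := M
  obtain rfl : pc = _ := hpc
  obtain ⟨hs, g, small, H, hD, hn, hI, hv⟩ := hinv
  have hv := hv v rfl
  by_cases hc : v k ≤ v best
  · refine ⟨⟨.afterScan k best, cls⟩, _, _, step_compare_yes hs rfl hc,
      ⟨rfl, g, small, H, ?_, facts_afterScan hI' hn hI ?_⟩, .inr ⟨rfl, rank_afterScan _ _ _ _⟩⟩
    · rw [merging_afterScan]; exact hD
    · intro i hi
      rcases hi.lt_or_eq with hi | rfl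
      exacts [hv i hi, hc]
  · refine ⟨⟨.afterScan k k, cls⟩, _, _, step_compare_no hs rfl hc,
      ⟨rfl, g, small, H, ?_, facts_afterScan hI' hn hI ?_⟩, .inr ⟨rfl, rank_afterScan _ _ _ _⟩⟩
    · rw [merging_afterScan]; exact hD
    · intro i hi
      rcases hi.lt_or_eq with hi | rfl
      exacts [(hv i hi).trans (not_le.1 hc).le, le_rfl]

lemma stepOK_classify {best : Fin d} {j : Fin m} (hinv : Inv r I M s (v :: rest))
    (hpc : M.pc = .classify best j) : StepOK r I M s v rest := by
  obtain ⟨pc, cls⟩ := M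
  obtain rfl : pc = _ := hpc
  obtain ⟨hs, g, small, H, hD, hn, hI, w, hw, hmax, hj⟩ := hinv
  obtain rfl : v = w := by simpa using hw
  by_cases hc : v best ≤ (1 / 2 : ℝ) ^ ((j : ℕ) + 1)
  · refine ⟨⟨.afterClassify best j, cls⟩, _, _, step_const_yes hs rfl
      (by push_cast; exact hc), ⟨rfl, g, small, H, ?_, ?_⟩, .inr ⟨rfl, ?_⟩⟩
    · unfold PC.afterClassify; split_ifs <;> exact hD
    · unfold PC.afterClassify
      split_ifs with h
      · exact ⟨hn, hI, v, rfl, hmax, hc⟩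
      · refine ⟨hn, hI, v, rfl, hmax, ?_⟩
        rwa [show (j : ℕ) + 1 = m by omega] at hc
    · unfold PC.afterClassify
      split_ifs with h
      · refine rank_lt_of_snd rfl ?_
        simp only [Meta.rank, ofLex_toLex]
        omega
      · exact rank_lt_of_fst (by simp [Meta.rank])
  · refine ⟨⟨.locate best j 0, cls⟩, _, _, step_const_no hs rfl
      (by push_cast; exact hc), ⟨rfl, g, small, H, hD, hn, hI, v, rfl, hmax,
        ⟨not_le.1 hc, hj⟩, [], g j, rfl, rfl, by simp⟩, .inr ⟨rfl, ?_⟩⟩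
    exact rank_lt_of_fst (by simp [Meta.rank])

lemma stepOK_small (hI' : ∀ w ∈ I, IsItem w) {best : Fin d} (hinv : Inv r I M s (v :: rest))
    (hpc : M.pc = .small best) : StepOK r I M s v rest := by
  obtain ⟨pc, cls⟩ := M
  obtain rfl : pc = _ := hpc
  obtain ⟨hs, g, small, H, hD, hn, hI, w, hw, hmax, hj⟩ := hinv
  obtain rfl : v = w := by simpa using hw
  have hv := hI' v (by simp [hI])
  refine ⟨⟨.done, cls⟩, _, _, step_assign hs rfl, ⟨rfl, g, small ++ [v best], H ++ [v],
    ⟨hD.cls, ?_, ?_⟩, ?_, ?_, by simp⟩, .inr ⟨rfl, rank_lt_of_fst (by simp [Meta.rank])⟩⟩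
  · rw [norms_append_singleton, ← hD.items, norm_eq_of_isMax hv hmax, ← Multiset.coe_add,
      add_assoc, add_comm _ (itemsOf g), ← add_assoc, Multiset.coe_singleton, add_comm,
      Multiset.singleton_add]
  · intro x hx
    rcases List.mem_append.1 hx with hx | hx
    · exact hD.small_le x hx
    · obtain rfl : x = v best := by simpa using hx
      exact ⟨(hv best).1, hj⟩
  · rw [List.map_cons, List.map_drop]
    have := eval_copyWords s.nums v
    rw [hn, hD.nums_length] at this
    simp only [hn, this]
    simp [LinComb.eval, Source.eval]
  · simp [hI]

lemma stepOK_locate {best : Fin d} {j : Fin m} {pos : ℕ} (hinv : Inv r I M s (v :: rest))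
    (hpc : M.pc = .locate best j pos) : StepOK r I M s v rest := by
  obtain ⟨pc, cls⟩ := M
  obtain rfl : pc = _ := hpc
  obtain ⟨hs, g, small, H, hD, hn, hI, w, hw, hmax, hj, A, C, hg, hA, hAv⟩ := hinv
  obtain rfl : v = w := by simpa using hw
  have hlen : (cls j).tl.length = A.length + C.length := by
    rw [(hD.cls j).code, List.length_map, hg, List.length_append]
  cases C with
  | nil =>
    have hp : program r (⟨.locate best j pos, cls⟩ : Meta d m) = _ :=
      if_neg (show ¬ pos < (cls j).tl.length by rw [hlen]; simp [hA])
    refine ⟨⟨.insert best j pos, cls⟩, _, _, step_compare_yes hs hp le_rfl,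
      ⟨rfl, g, small, H, hD, hn, hI, v, rfl, hmax, hj, A, [], hg, hA, hAv, by simp⟩,
      .inr ⟨rfl, rank_lt_of_fst (by simp [Meta.rank])⟩⟩
  | cons t C =>
    have hp : program r (⟨.locate best j pos, cls⟩ : Meta d m) = _ :=
      if_pos (show pos < (cls j).tl.length by rw [hlen]; simp [hA])
    have hval : Source.eval s.nums v (.word (1 + offset cls j + pos)) = t.val := by
      obtain ⟨X, Y, hX, hXY, -⟩ := nums_split hD j
      rw [Source.eval, hn, hXY, hg, List.map_append, List.append_assoc, ← List.append_assoc,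
        List.getD_append_right _ _ _ _ (by simp [hX, hA])]
      simp [hX, hA]
    by_cases hc : v best ≤ t.val
    · refine ⟨⟨.insert best j pos, cls⟩, _, _, step_compare_yes hs hp
        (by rw [hval]; exact hc),
        ⟨rfl, g, small, H, hD, hn, hI, v, rfl, hmax, hj, A, t :: C, hg, hA, hAv, ?_⟩,
        .inr ⟨rfl, rank_lt_of_fst (by simp [Meta.rank])⟩⟩
      have hsort := (hD.cls j).valid.sorted
      rw [hg, List.pairwise_append, List.pairwise_cons] at hsort
      intro u hu
      rcases List.mem_cons.1 hu with rfl | hu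
      · exact hc
      · exact hc.trans (hsort.2.1.1 u hu)
    · refine ⟨⟨.locate best j (pos + 1), cls⟩, _, _, step_compare_no hs hp
        (by rw [hval]; exact hc),
        ⟨rfl, g, small, H, hD, hn, hI, v, rfl, hmax, hj, A ++ [t], C, by simp [hg],
          by simp [hA], ?_⟩, .inr ⟨rfl, rank_lt_of_snd rfl ?_⟩⟩
      · intro u hu
        rcases List.mem_append.1 hu with hu | hu
        · exact hAv u hu
        · obtain rfl : u = t := by simpa using hu
          exact not_le.1 hc
      · simp only [Meta.rank, ofLex_toLex, hlen, List.length_cons]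
        omega

lemma stepOK_insert (hrm : r ≤ m) (hI' : ∀ w ∈ I, IsItem w) {best : Fin d} {j : Fin m} {pos : ℕ}
    (hinv : Inv r I M s (v :: rest)) (hpc : M.pc = .insert best j pos) :
    StepOK r I M s v rest := by
  obtain ⟨pc, cls⟩ := M
  obtain rfl : pc = _ := hpc
  obtain ⟨hs, g, small, H, hD, hn, hI, w, hw, hmax, hj, A, C, hg, hA, hAv, hCv⟩ := hinv
  obtain rfl : v = w := by simpa using hw
  have hv := hI' v (by simp [hI])
  have hcls := (hD.cls j).congr (q := False) (by simp [PC.merging])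
  rw [hg] at hcls
  have hins := hcls.insert hrm hAv hCv hj
  set l := A ++ Tup.new (v best) (cls j).time :: C with hl
  refine ⟨⟨.afterInsert r cls j, Function.update cls j ((cls j).insert r m j pos)⟩, _, _,
    step_assign hs rfl, ⟨rfl, Function.update g j l, small, H ++ [v], ⟨?_, ?_, hD.small_le⟩, ?_⟩,
    .inr ⟨rfl, rank_lt_of_fst ?_⟩⟩
  · intro i
    simp only
    by_cases hi : i = j
    · subst hi
      rw [Function.update_self, Function.update_self, ← hA]
      refine hins.congr ?_
      unfold PC.afterInsert
      split_ifs with hb <;> simp [hb, PC.merging]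
    · rw [Function.update_of_ne hi, Function.update_of_ne hi]
      refine (hD.cls i).congr ?_
      unfold PC.afterInsert
      split_ifs with hb <;> simp [PC.merging, Ne.symm hi]
  · rw [norms_append_singleton, ← hD.items, norm_eq_of_isMax hv hmax,
      itemsOf_update_cons g j l (v best, (cls j).time) (by
        rw [hg]; exact allItems_insert_perm A C (v best) _), Multiset.add_cons]
  · have hnums : List.map (fun e => LinComb.eval s.nums v e)
        ((copyWords d (tuples cls + 1)).take (1 + offset cls j + pos) ++
          [(1, .coord best)] :: (copyWords d (tuples cls + 1)).drop (1 + offset cls j + pos)) =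
        small.sum :: flat (Function.update g j l) := by
      have hc := eval_copyWords s.nums v
      have hlen := hD.nums_length small.sum
      rw [← hn] at hlen
      rw [hlen] at hc
      obtain ⟨X, Y, hX, hXY, hXl⟩ := nums_split hD j
      have hp : 1 + offset cls j + pos = (X ++ A.map Tup.val).length := by simp [hX, hA]
      have hs2 : s.nums = (X ++ A.map Tup.val) ++ (C.map Tup.val ++ Y) := by
        rw [hn, hXY, hg]; simp
      rw [List.map_append, List.map_cons, List.map_take, List.map_drop, hc, eval_coord, hp, hXl]
      conv_lhs => rw [hs2]
      rw [List.take_left, List.drop_left, hl]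
      simp [Tup.new]
    unfold PC.afterInsert
    split_ifs with hb
    · exact ⟨hnums, by simp [hI], by simp⟩
    · exact ⟨hnums, by simp [hI], by simp⟩
  · unfold PC.afterInsert
    split_ifs <;> simp [Meta.rank]

lemma stepOK_merge (hrm : r ≤ m) {j : Fin m}
    (hinv : Inv r I M s (v :: rest)) (hpc : M.pc = .merge j) :
    StepOK r I M s v rest := by
  classical
  obtain ⟨pc, cls⟩ := M
  obtain rfl : pc = _ := hpc
  obtain ⟨hs, g, small, H, hD, hn, hI, -⟩ := hinv
  have hcls := (hD.cls j).congr (q := True) (by simp [PC.merging])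
  by_cases hx : ∃ x, Mergeable (cls j) x
  · have hp : program r (⟨.merge j, cls⟩ : Meta d m) = _ := dif_pos hx
    obtain ⟨hx1, hx2⟩ := hx.choose_spec
    set x := hx.choose
    have hcode := (hD.cls j).code
    rw [hx1] at hcode
    -- The algorithm finds the splitting among the codes; it lifts to a splitting of the tuples
    -- themselves.
    obtain ⟨AR, kC, hg, hAR, hkC⟩ := List.map_eq_append_iff.1 hcode.symm
    obtain ⟨A, R, rfl, hA, hR⟩ := List.map_eq_append_iff.1 hAR
    obtain ⟨k, C, rfl, hk, hC⟩ := List.map_eq_cons_iff.1 hkC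
    rw [← hA, ← hR, ← hk] at hx2
    rw [hg] at hcls
    have hmer := hcls.merge hx2
    have hcls' : (cls j).merge x =
        ⟨(cls j).time, (cls j).cnt, (A ++ k.absorb R :: C).map Tup.code⟩ := by
      rw [Cls.merge, List.map_append, List.map_cons, code_absorb, hA, hR, hk, hC]
    refine ⟨⟨.merge j, Function.update cls j ((cls j).merge x)⟩, _, _,
      step_assign hs hp, ⟨rfl, Function.update g j (A ++ k.absorb R :: C), small, H,
        ⟨?_, ?_, hD.small_le⟩, ?_, hI, by simp⟩, .inr ⟨rfl, rank_lt_of_snd rfl ?_⟩⟩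
    · intro i
      simp only
      by_cases hi : i = j
      · subst hi
        rw [Function.update_self, Function.update_self, hcls']
        exact hmer.congr (by simp [PC.merging])
      · rw [Function.update_of_ne hi, Function.update_of_ne hi]
        exact hD.cls i
    · rw [itemsOf_update_perm, hD.items]
      rw [hg]
      exact allItems_merge_perm A R C k
    · have hc := eval_copyWords s.nums v
      have hlen := hD.nums_length small.sum
      rw [← hn] at hlen
      rw [hlen] at hc
      obtain ⟨X, Y, hX, hXY, hXl⟩ := nums_split hD j
      have hp : 1 + offset cls j + x.1.length = (X ++ A.map Tup.val).length := by
        rw [← hA]; simp [hX]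
      have hp2 : 1 + offset cls j + x.1.length + x.2.1.length =
          (X ++ A.map Tup.val ++ R.map Tup.val).length := by
        rw [← hA, ← hR]; simp [hX, add_assoc]
      have hs2 : s.nums = (X ++ A.map Tup.val) ++ (R.map Tup.val ++ (k :: C).map Tup.val ++ Y) := by
        rw [hn, hXY, hg]; simp
      have hs3 : s.nums = (X ++ A.map Tup.val ++ R.map Tup.val) ++ ((k :: C).map Tup.val ++ Y) := by
        rw [hn, hXY, hg]; simp
      have e1 : s.nums.take (1 + offset cls j + x.1.length) = X ++ A.map Tup.val := by
        rw [hp, hs2, List.take_left]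
      have e2 : s.nums.drop (1 + offset cls j + x.1.length + x.2.1.length) =
          (k :: C).map Tup.val ++ Y := by
        rw [hp2, hs3, List.drop_left]
      simp only
      rw [List.map_append, List.map_take, List.map_drop, hc, hXl, e1, e2]
      simp [Tup.absorb]
    · have hRne : 0 < R.length := by
        rw [List.length_pos_iff]
        rintro rfl
        exact hx2.ne rfl
      have hl : (cls j).tl.length = A.length + R.length + (C.length + 1) := by
        rw [(hD.cls j).code, List.length_map, hg]; simp [add_assoc]
      simp only [Meta.rank, ofLex_toLex, Function.update_self, hcls', hl, List.length_map,
        List.length_append, List.length_cons]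
      omega
  · have hp : program r (⟨.merge j, cls⟩ : Meta d m) = _ := dif_neg hx
    refine ⟨⟨.scan 0 0, cls⟩, _, _, step_next hs hp, ⟨rfl, g, small, H,
      ⟨?_, hD.items, hD.small_le⟩, hn, hI, by simp⟩, .inl (by simp)⟩
    intro i
    by_cases hi : i = j
    · subst hi
      -- The failed search for a mergeable splitting is precisely `Stuck`.
      refine (hcls.finish hrm ?_).congr (by simp [PC.merging])
      intro A R k C h hm
      exact hx ⟨(A, R, k, C), h, hm⟩
    · refine (hD.cls i).congr ?_
      simp [PC.merging, Ne.symm hi]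

lemma stepOK (hrm : r ≤ m) (hI' : ∀ w ∈ I, IsItem w) (hinv : Inv r I M s (v :: rest)) :
    StepOK r I M s v rest := by
  cases hpc : M.pc with
  | init => exact stepOK_init hinv hpc
  | scan k best => exact stepOK_scan hI' hinv hpc
  | classify best j => exact stepOK_classify hinv hpc
  | small best => exact stepOK_small hI' hinv hpc
  | locate best j pos => exact stepOK_locate hinv hpc
  | insert best j pos => exact stepOK_insert hrm hI' hinv hpc
  | merge j => exact stepOK_merge hrm hinv hpc
  | done => exact stepOK_done hinv hpc

lemma inv_init (r : ℕ) (I : List (Fin d → ℝ)) :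
    Inv r I (⟨.init, fun _ => ⟨0, 0, []⟩⟩ : Meta d m) ⟨(algorithm d m r).init, []⟩ I := by
  refine ⟨rfl, fun _ => [], [], [], ⟨fun j => (clsInv_empty r m j).congr (by simp [PC.merging]),
    ?_, by simp⟩, rfl, fun _ => rfl, rfl, rfl⟩
  simp [itemsOf, norms]

/-- Steps are deterministic, so the successor exhibited by `stepOK` is the one that the computation
took. -/
lemma inv_of_reaches (hrm : r ≤ m) (hI' : ∀ w ∈ I, IsItem w)
    (h : (algorithm d m r).Reaches I s rest) : ∃ M : Meta d m, Inv r I M s rest := by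
  unfold StreamingAlgorithm.Reaches at h
  generalize hx : (s, rest) = x at h
  induction h generalizing s rest with
  | refl =>
    obtain ⟨rfl, rfl⟩ := Prod.mk.inj hx
    exact ⟨_, inv_init r _⟩
  | @tail y z _ hyz ih =>
    subst hx
    obtain ⟨s', rest'⟩ := y
    obtain ⟨M, hM⟩ := ih rfl
    cases rest' with
    | nil => simp [StreamingAlgorithm.step] at hyz
    | cons v rest' =>
      obtain ⟨M', s'', rest'', hstep, hinv, -⟩ := stepOK hrm hI' hM
      rw [hstep] at hyz
      simp only [Option.some.injEq, Prod.mk.injEq] at hyz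
      obtain ⟨rfl, rfl⟩ := hyz
      exact ⟨M', hinv⟩

/-- Termination by nested induction: on the length of the remaining stream, and for a fixed length
on the rank. -/
lemma exists_reaches_of_inv (hrm : r ≤ m) (hI' : ∀ w ∈ I, IsItem w) (n : ℕ) (o : ℕ ×ₗ ℕ)
    (hn : rest.length = n) (ho : M.rank = o) (hinv : Inv r I M s rest) :
    ∃ s', Relation.ReflTransGen (fun x y => (algorithm d m r).step x = some y)
      (s, rest) (s', []) := by
  induction n using Nat.strong_induction_on generalizing o M s rest with
  | _ n ihn =>
  induction o using WellFoundedLT.induction generalizing M s rest with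
  | _ o iho =>
  cases rest with
  | nil => exact ⟨s, .refl⟩
  | cons v rest =>
    obtain ⟨M', s', rest', hstep, hinv', hp⟩ := stepOK hrm hI' hinv
    rcases hp with hp | ⟨hp, hr⟩
    · obtain ⟨s'', hs''⟩ := ihn rest'.length (hn ▸ hp) _ rfl rfl hinv'
      exact ⟨s'', .head hstep hs''⟩
    · obtain ⟨s'', hs''⟩ := iho M'.rank (ho ▸ hr) (hp.trans hn) rfl hinv'
      exact ⟨s'', .head hstep hs''⟩

lemma exists_reaches (hrm : r ≤ m) (hI' : ∀ w ∈ I, IsItem w) :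
    ∃ s, (algorithm d m r).Reaches I s [] :=
  exists_reaches_of_inv hrm hI' _ _ rfl rfl (inv_init (m := m) r I)

end Steps

end Program

/-! ### Accuracy -/

/-- The numbers stored in a summary, with multiplicities. -/
def reps (l : List Tup) : List ℝ := l.flatMap fun t => List.replicate (t.abs.length + 1) t.val

@[simp] lemma reps_nil : reps [] = [] := rfl
@[simp] lemma reps_cons (t : Tup) (l : List Tup) :
    reps (t :: l) = List.replicate (t.abs.length + 1) t.val ++ reps l := rfl

lemma coe_flatten_flatMap {α β : Type*} (L : List (List α)) (φ : α → List β) :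
    ((L.flatten.flatMap φ : List β) : Multiset β) =
      (L.map fun l => ((l.flatMap φ : List β) : Multiset β)).sum := by
  induction L with
  | nil => rfl
  | cons l L ih =>
    rw [List.flatten_cons, List.flatMap_append, ← Multiset.coe_add, ih, List.map_cons,
      List.sum_cons]

lemma rounded_eq {d m : ℕ} (M : Meta d m) (g : Fin m → List Tup) (nums : List ℝ)
    (hn : nums.tail = flat g) (hc : ∀ j, (M.cls j).tl = (g j).map Tup.code) :
    rounded M nums = ∑ j, (reps (g j) : Multiset ℝ) := by
  have h1 : (List.ofFn fun j => (M.cls j).tl).flatten = (List.ofFn g).flatten.map Tup.code := by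
    rw [List.map_flatten, List.map_ofFn]
    congr 2; funext j; exact hc j
  have h2 : flat g = (List.ofFn g).flatten.map Tup.val := by
    rw [flat, List.map_flatten, List.map_ofFn]; rfl
  rw [rounded, hn, h1, h2, List.zipWith_map, List.zipWith_self, ← List.flatMap_def]
  simp only [Tup.code]
  rw [coe_flatten_flatMap, List.map_ofFn, List.sum_ofFn]
  rfl

lemma dominated_sum {ι : Type*} (s : Finset ι) (f g : ι → Multiset ℝ)
    (h : ∀ i ∈ s, Dominated (f i) (g i)) : Dominated (∑ i ∈ s, f i) (∑ i ∈ s, g i) := by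
  classical
  induction s using Finset.induction_on with
  | empty => exact Dominated.refl _
  | insert i s hi ih =>
    rw [Finset.sum_insert hi, Finset.sum_insert hi]
    exact (h i (by simp)).add (ih fun j hj => h j (by simp [hj]))

lemma countP_replicate_val (n : ℕ) (x y : ℝ) :
    (List.replicate n x).countP (fun z => y ≤ z) = if y ≤ x then n else 0 := by
  rw [List.countP_replicate]; simp

lemma items_dominated_reps {l : List Tup} (h : ∀ t ∈ l, ∀ x ∈ t.abs, x.1 ≤ t.val) :
    Dominated ((allItems l).map Prod.fst : Multiset ℝ) (reps l : Multiset ℝ) := by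
  induction l with
  | nil => exact Dominated.refl _
  | cons t l ih =>
    rw [allItems_cons, reps_cons, List.map_append, ← Multiset.coe_add, ← Multiset.coe_add]
    refine Dominated.add (fun y => ?_) (ih fun s hs => h s (by simp [hs]))
    rw [Multiset.coe_countP, Multiset.coe_countP, countP_replicate_val]
    split_ifs with hy
    · exact List.countP_le_length.trans (by simp [Tup.items])
    · rw [Nat.le_zero, List.countP_eq_zero]
      intro x hx
      simp only [Tup.items, List.map_cons, List.mem_cons, List.mem_map] at hx
      rcases hx with rfl | ⟨x, hx, rfl⟩
      · simpa using hy
      · simpa using (h t (by simp) x hx).trans_lt (not_le.1 hy)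

lemma length_reps (l : List Tup) : (reps l).length = (allItems l).length := by
  induction l with
  | nil => rfl
  | cons t l ih => simp [ih, Tup.items, add_right_comm]

/-- At every threshold, rounding increases the number of large items by at most `T`. -/
lemma countP_reps_le {T : ℕ} {l : List Tup} (hs : l.Pairwise fun s t => s.val ≤ t.val)
    (hc : ∀ t ∈ l, t.abs.length + t.time ≤ T) (hj : Jump l) (y : ℝ) :
    (reps l).countP (fun x => y ≤ x) ≤ ((allItems l).map Prod.fst).countP (fun x => y ≤ x) + T := by
  induction l with
  | nil => simp
  | cons t l ih =>
    by_cases hy : y ≤ t.val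
    · have hall : ∀ u ∈ t :: l, y ≤ u.val := by
        intro u hu
        rcases List.mem_cons.1 hu with rfl | hu
        · exact hy
        · exact hy.trans ((List.pairwise_cons.1 hs).1 u hu)
      have h1 := countP_val_lt_le hs hc hj hall
      have h2 : (reps (t :: l)).countP (fun x => y ≤ x) ≤ (allItems (t :: l)).length :=
        List.countP_le_length.trans (length_reps _).le
      have h3 := List.length_eq_countP_add_countP (fun x : ℝ × ℕ => decide (y ≤ x.1))
        (l := allItems (t :: l))
      have h4 : (allItems (t :: l)).countP (fun x => decide ¬ (decide (y ≤ x.1) = true)) =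
          (allItems (t :: l)).countP (fun x => x.1 < y) := by
        congr 1; ext x; simp
      rw [h4] at h3
      rw [List.countP_map]
      exact h2.trans (h3.le.trans (Nat.add_le_add_left h1 _))
    · have := ih (List.pairwise_cons.1 hs).2 (fun u hu => hc u (by simp [hu])) hj.2
      rw [reps_cons, List.countP_append, countP_replicate_val, if_neg hy, allItems_cons,
        List.map_append, List.countP_append]
      omega

/-- The numbers that make up for the rounding. -/
noncomputable def slack {m : ℕ} (cls : Fin m → Cls) : Multiset ℝ :=
  ∑ j, Multiset.replicate (cls j).time ((1 / 2 : ℝ) ^ (j : ℕ))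

/-- Up to `2 ^ (-j)`, the copies make up for the surplus of `countP_reps_le`; above it the class has
no representatives. -/
lemma ClsInv.reps_dominated {r m j : ℕ} {c : Cls} {g : List Tup} {p : Prop}
    (h : ClsInv r m j c g p) : Dominated (reps g : Multiset ℝ)
      (((allItems g).map Prod.fst : Multiset ℝ) +
        Multiset.replicate c.time ((1 / 2 : ℝ) ^ j)) := by
  intro y
  rw [Multiset.countP_add, ← Multiset.coe_replicate, Multiset.coe_countP, Multiset.coe_countP,
    Multiset.coe_countP, countP_replicate_val]
  split_ifs with hy
  · exact countP_reps_le h.valid.sorted h.valid.cap h.valid.jump y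
  · rw [List.countP_eq_zero.2]
    · exact Nat.zero_le _
    · intro x hx
      obtain ⟨t, ht, hx⟩ := List.mem_flatMap.1 hx
      obtain rfl := List.eq_of_mem_replicate hx
      have := (h.range (t.val, t.time) (mem_allItems.2 ⟨t, ht, .inl rfl⟩)).2
      simpa using this.trans_lt (not_le.1 hy)

lemma le_arrived (r m j T : ℕ) : T ≤ arrived r m j T := by
  unfold arrived
  have h1 : 1 ≤ 2 ^ r := Nat.one_le_two_pow
  have h2 : 1 ≤ 2 ^ m := Nat.one_le_two_pow
  have h3 := Nat.mul_le_mul_right (min T (2 ^ j * 2 ^ m)) h1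
  have h4 := Nat.mul_le_mul_right (T - 2 ^ j * 2 ^ m) h2
  rw [one_mul] at h3 h4
  have : T = min T (2 ^ j * 2 ^ m) + (T - 2 ^ j * 2 ^ m) := by omega
  omega

lemma ClsInv.card_le_sum {r m j : ℕ} {c : Cls} {g : List Tup} {p : Prop}
    (h : ClsInv r m j c g p) :
    ((allItems g).length : ℝ) ≤ 2 ^ (j + 1) * ((allItems g).map Prod.fst).sum := by
  have h1 : ∀ l : List (ℝ × ℕ), (∀ x ∈ l, (1 / 2 : ℝ) ^ (j + 1) < x.1) →
      (l.length : ℝ) ≤ 2 ^ (j + 1) * (l.map Prod.fst).sum := by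
    intro l
    induction l with
    | nil => simp
    | cons x l ih =>
      intro hx
      have h1 := ih fun y hy => hx y (by simp [hy])
      have h2 := hx x (by simp)
      have h3 : (2 : ℝ) ^ (j + 1) * (1 / 2 : ℝ) ^ (j + 1) = 1 := by
        rw [← mul_pow]; norm_num
      have h4 : (2 : ℝ) ^ (j + 1) * (1 / 2 : ℝ) ^ (j + 1) ≤ 2 ^ (j + 1) * x.1 :=
        mul_le_mul_of_nonneg_left h2.le (by positivity)
      simp only [List.length_cons, List.map_cons, List.sum_cons]
      push_cast
      rw [mul_add]
      linarith
  exact h1 _ fun x hx => (h.range x hx).1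

/-- The first `2 ^ j * 2 ^ m` time steps contribute `2 ^ m` to the left side. Every later one
consumed `2 ^ m` items larger than `2 ^ (-(j + 1))` and is paid for by their volume. -/
lemma ClsInv.time_le {r m j : ℕ} {c : Cls} {g : List Tup} {p : Prop}
    (h : ClsInv r m j c g p) :
    (c.time : ℝ) * (1 / 2) ^ j ≤ 2 * ((allItems g).map Prod.fst).sum / 2 ^ m + 2 ^ m := by
  have h1 := h.card_le_sum
  have h2 : 2 ^ m * c.time ≤ (allItems g).length + 2 ^ m * (2 ^ j * 2 ^ m) := by
    rw [h.card, arrived]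
    have : 2 ^ m * c.time ≤ 2 ^ m * ((c.time - 2 ^ j * 2 ^ m) + 2 ^ j * 2 ^ m) :=
      Nat.mul_le_mul_left _ (by omega)
    rw [mul_add] at this
    omega
  have h3 : (2 : ℝ) ^ m * c.time ≤ (allItems g).length + 2 ^ m * (2 ^ j * 2 ^ m) := by
    exact_mod_cast h2
  set S := ((allItems g).map Prod.fst).sum
  have hm : (0 : ℝ) < 2 ^ m := by positivity
  have hj : (0 : ℝ) < 2 ^ j := by positivity
  rw [one_div, inv_pow, ← div_eq_mul_inv, div_le_iff₀ hj]
  have e : (2 * S / 2 ^ m + 2 ^ m) * 2 ^ j = (2 ^ (j + 1) * S + 2 ^ m * (2 ^ j * 2 ^ m)) / 2 ^ m := by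
    field_simp; ring
  rw [e, le_div_iff₀ hm]
  linarith

section Accuracy

variable {d m r : ℕ} {H : List (Fin d → ℝ)} {cls : Fin m → Cls} {g : Fin m → List Tup}
  {small : List ℝ} {mg : Option (Fin m)}

lemma Data.nonneg_of_mem (h : Data r H cls g small mg) {x : ℝ} (hx : x ∈ itemsOf g) : 0 ≤ x := by
  obtain ⟨j, -, hx⟩ := Multiset.mem_sum.1 hx
  obtain ⟨y, hy, rfl⟩ := List.mem_map.1 (Multiset.mem_coe.1 hx)
  exact le_trans (by positivity) ((h.cls j).range y hy).1.le

lemma Data.items_dominated (h : Data r H cls g small mg) :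
    Dominated (itemsOf g) (∑ j, (reps (g j) : Multiset ℝ)) :=
  dominated_sum _ _ _ fun j _ => items_dominated_reps (h.cls j).valid.dom

lemma Data.reps_dominated (h : Data r H cls g small mg) :
    Dominated (∑ j, (reps (g j) : Multiset ℝ)) (itemsOf g + slack cls) := by
  rw [itemsOf, slack, ← Finset.sum_add_distrib]
  exact dominated_sum _ _ _ fun j _ => (h.cls j).reps_dominated

lemma mem_slack {x : ℝ} (hx : x ∈ slack cls) : 0 ≤ x ∧ x ≤ 1 := by
  obtain ⟨j, -, hx⟩ := Multiset.mem_sum.1 hx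
  obtain rfl := Multiset.eq_of_mem_replicate hx
  exact ⟨by positivity, pow_le_one₀ (by norm_num) (by norm_num)⟩

lemma itemsOf_sum (g : Fin m → List Tup) :
    (itemsOf g).sum = ∑ j, ((allItems (g j)).map Prod.fst).sum := by
  rw [itemsOf, Multiset.sum_sum]
  simp only [Multiset.sum_coe]

lemma Data.slack_sum_le (h : Data r H cls g small mg) :
    (slack cls).sum ≤ 2 * (itemsOf g).sum / 2 ^ m + m * 2 ^ m := by
  rw [slack, Multiset.sum_sum, itemsOf_sum, Finset.mul_sum, Finset.sum_div]
  have : (m : ℝ) * 2 ^ m = ∑ _j : Fin m, (2 : ℝ) ^ m := by simp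
  rw [this, ← Finset.sum_add_distrib]
  refine Finset.sum_le_sum fun j _ => ?_
  rw [Multiset.sum_replicate, nsmul_eq_mul]
  exact (h.cls j).time_le

lemma Data.small_sum_nonneg (h : Data r H cls g small mg) : 0 ≤ small.sum :=
  List.sum_nonneg fun x hx => (h.small_le x hx).1

lemma Data.sum_norms (h : Data r H cls g small mg) :
    (norms H : Multiset ℝ).sum = small.sum + (itemsOf g).sum := by
  rw [← h.items, Multiset.sum_add, Multiset.sum_coe]

end Accuracy

/-! ### Upper and lower bounds for the answer -/

section Answer

variable {d m r : ℕ} {I : List (Fin d → ℝ)} {M : Meta d m} {g : Fin m → List Tup}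
  {small nums : List ℝ} {mg : Option (Fin m)}

/-- Without a current item, only `init` and `scan` are possible. On the empty stream no number word
exists, and the defaults of `tail` and `headD` give the right values. -/
lemma headD_tail_of_facts {pc : PC d m} {s : List ℝ} {H : List (Fin d → ℝ)}
    (h : pc.Facts I H [] g small s) :
    s.tail = flat g ∧ s.headD 0 = small.sum ∧ I = H := by
  cases pc with
  | init =>
    obtain ⟨rfl, h2, rfl, h4⟩ := h
    exact ⟨by simp [flat, h2], by simp, by simpa using h4⟩
  | scan k best =>
    obtain ⟨rfl, h2, -⟩ := h
    exact ⟨rfl, rfl, by simpa using h2⟩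
  | classify _ _ => obtain ⟨-, -, v, hv, -⟩ := h; simp at hv
  | small _ => obtain ⟨-, -, v, hv, -⟩ := h; simp at hv
  | locate _ _ _ => obtain ⟨-, -, v, hv, -⟩ := h; simp at hv
  | insert _ _ _ => obtain ⟨-, -, v, hv, -⟩ := h; simp at hv
  | merge _ => exact absurd rfl h.2.2
  | done => exact absurd rfl h.2.2

/-- A number of bins that the final computation accepts. -/
lemma exists_accepted (h : Data r I M.cls g small mg) (hm : 0 < m) {K : ℕ}
    (hK : Packs (norms I : Multiset ℝ) K) (hR : rounded M nums = ∑ j, (reps (g j) : Multiset ℝ))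
    (hW : nums.headD 0 = small.sum) (hb : (16 : ℝ) ≤ 2 ^ m) :
    ∃ n : ℕ, (Packs (rounded M nums) n ∧
      (rounded M nums).sum + nums.headD 0 ≤ n * (1 - (1 / 2 : ℝ) ^ m)) ∧
      (n : ℝ) ≤ K + 5 * K / 2 ^ m + 2 * (m * 2 ^ m) + 1 := by
  have hS := h.slack_sum_le
  have hsum := h.sum_norms
  have hKs := hK.sum_le
  have hs0 := h.small_sum_nonneg
  have hX0 : 0 ≤ (slack M.cls).sum := Multiset.sum_nonneg fun x hx => (mem_slack hx).1
  obtain ⟨nx, hnx, hnx'⟩ := exists_packs (s := slack M.cls) fun x hx => mem_slack hx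
  have hitems : Packs (itemsOf g) K := by
    refine Dominated.packs (fun y => ?_) ?_ hK
    · rw [← h.items]
      exact Multiset.countP_le_of_le _ (Multiset.le_add_left _ _)
    · intro x hx
      obtain ⟨v, -, rfl⟩ := List.mem_map.1 (Multiset.mem_coe.1 hx)
      exact norm_nonneg v
  have hnn : ∀ x ∈ itemsOf g + slack M.cls, 0 ≤ x := by
    intro x hx
    rcases Multiset.mem_add.1 hx with hx | hx
    · exact h.nonneg_of_mem hx
    · exact (mem_slack hx).1
  have hpack := h.reps_dominated.packs hnn (hitems.add hnx)
  have hvol := h.reps_dominated.sum_le hnn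
  rw [Multiset.sum_add] at hvol
  rw [hR, hW]
  set X := (slack M.cls).sum
  set R := ∑ j, (reps (g j) : Multiset ℝ)
  set b : ℝ := 2 ^ m with hbdef
  have hinv : (1 / 2 : ℝ) ^ m = 1 / b := by rw [hbdef, one_div, inv_pow, one_div]
  have hb0 : 0 < b := by positivity
  have hmR : (1 : ℝ) ≤ m := by exact_mod_cast hm
  have hKb : 0 ≤ (K : ℝ) / b := by positivity
  have hXK : X ≤ 2 * (K / b) + m * b := by
    refine hS.trans ?_
    have : (itemsOf g).sum ≤ K := by linarith
    have : 2 * (itemsOf g).sum / b ≤ 2 * K / b := by gcongr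
    rw [mul_div_assoc 2 (K : ℝ)] at this
    linarith
  have hmb : 0 ≤ m * b := by positivity
  rw [hinv]
  -- Enough bins for the volume test: `(1 + 2 / b) * (1 - 1 / b) ≥ 1` compensates for the reserve of
  -- `1 / b` in each bin.
  set n2 := ⌈(K + X) * (1 + 2 / b)⌉₊
  have hn2 : (K + X) * (1 + 2 / b) ≤ n2 := Nat.le_ceil _
  have hn2' : (n2 : ℝ) < (K + X) * (1 + 2 / b) + 1 := Nat.ceil_lt_add_one (by positivity)
  have h1b : 1 / b ≤ 1 / 16 := one_div_le_one_div_of_le (by norm_num) hb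
  refine ⟨max (K + nx) n2, ⟨hpack.mono (le_max_left _ _), ?_⟩, ?_⟩
  · have hmax : (n2 : ℝ) ≤ (max (K + nx) n2 : ℕ) := by exact_mod_cast le_max_right _ _
    have h2 : 1 ≤ (1 + 2 / b) * (1 - 1 / b) := by
      have e : 2 / b = 2 * (1 / b) := by ring
      have : 0 < 1 / b := by positivity
      rw [e]; nlinarith
    have h3 : 0 ≤ 1 - 1 / b := by linarith
    calc R.sum + small.sum ≤ K + X := by linarith
      _ ≤ (K + X) * ((1 + 2 / b) * (1 - 1 / b)) := le_mul_of_one_le_right (by positivity) h2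
      _ = (K + X) * (1 + 2 / b) * (1 - 1 / b) := by ring
      _ ≤ (max (K + nx) n2 : ℕ) * (1 - 1 / b) :=
        mul_le_mul_of_nonneg_right (hn2.trans hmax) h3
  · rw [Nat.cast_max, max_le_iff]
    have e5 : 5 * (K : ℝ) / b = 5 * (K / b) := by ring
    rw [e5]
    refine ⟨?_, ?_⟩
    · push_cast; linarith
    · have e : (K + X) * (1 + 2 / b) = K + 2 * (K / b) + X + 2 * (1 / b) * X := by
        field_simp; ring
      have : 1 / b * X ≤ 1 / 16 * X := mul_le_mul_of_nonneg_right h1b hX0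
      linarith

lemma OPT_le_answer (h : Data r I M.cls g small mg) (hm : 0 < m) {K : ℕ}
    (hK : Packs (norms I : Multiset ℝ) K) (hR : rounded M nums = ∑ j, (reps (g j) : Multiset ℝ))
    (hW : nums.headD 0 = small.sum) (hb : (16 : ℝ) ≤ 2 ^ m) :
    OPT I ≤ answer M nums := by
  obtain ⟨n, hn, -⟩ := exists_accepted h hm hK hR hW hb
  have hmem := Nat.sInf_mem (s := {n : ℕ | Packs (rounded M nums) n ∧
    (rounded M nums).sum + nums.headD 0 ≤ n * (1 - (1 / 2 : ℝ) ^ m)}) ⟨n, hn⟩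
  rw [answer]
  set k := sInf {n : ℕ | Packs (rounded M nums) n ∧
    (rounded M nums).sum + nums.headD 0 ≤ n * (1 - (1 / 2 : ℝ) ^ m)}
  obtain ⟨h1, h2⟩ := hmem
  have hle : (1 / 2 : ℝ) ^ m ≤ 1 := pow_le_one₀ (by norm_num) (by norm_num)
  have hpk : Packs (rounded M nums + (small : Multiset ℝ)) (1 + k) := by
    refine (h1.mono (Nat.le_add_left _ _)).greedy (e := (1 / 2 : ℝ) ^ m)
      (fun x hx => h.small_le x (Multiset.mem_coe.1 hx)) ?_ fun _ => by omega
    rw [Multiset.sum_coe, ← hW]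
    refine h2.trans (mul_le_mul_of_nonneg_right ?_ (by linarith))
    push_cast; linarith
  -- Rounding only increases sizes, so a packing of the rounded items together with the small ones
  -- yields a packing of the true norms.
  refine OPT_le_of_packs (Dominated.packs ?_ ?_ hpk)
  · rw [← h.items, hR, add_comm]
    exact h.items_dominated.add (Dominated.refl _)
  · intro x hx
    rcases Multiset.mem_add.1 hx with hx | hx
    · rw [hR] at hx
      obtain ⟨j, -, hx⟩ := Multiset.mem_sum.1 hx
      obtain ⟨t, ht, hx⟩ := List.mem_flatMap.1 (Multiset.mem_coe.1 hx)
      obtain rfl := List.eq_of_mem_replicate hx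
      exact le_trans (by positivity)
        ((h.cls j).range (t.val, t.time) (mem_allItems.2 ⟨t, ht, .inl rfl⟩)).1.le
    · exact (h.small_le x (Multiset.mem_coe.1 hx)).1

lemma answer_le (h : Data r I M.cls g small mg) (hm : 0 < m) {K : ℕ}
    (hK : Packs (norms I : Multiset ℝ) K) (hR : rounded M nums = ∑ j, (reps (g j) : Multiset ℝ))
    (hW : nums.headD 0 = small.sum) (hb : (16 : ℝ) ≤ 2 ^ m) :
    (answer M nums : ℝ) ≤ K + 5 * K / 2 ^ m + 2 * (m * 2 ^ m) + 2 := by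
  obtain ⟨n, hn, hle⟩ := exists_accepted h hm hK hR hW hb
  have : answer M nums ≤ 1 + n := Nat.add_le_add_left (Nat.sInf_le hn) 1
  have : (answer M nums : ℝ) ≤ 1 + n := by exact_mod_cast this
  linarith

end Answer

/-! ### Memory -/

/-- Sums of norms of distinct vectors of the list are combinations of their coordinates. -/
lemma exists_coeff {d : ℕ} (hd : 0 < d) {I : List (Fin d → ℝ)} (hI : ∀ v ∈ I, IsItem v)
    {s : Multiset ℝ} (hs : s ≤ (norms I : Multiset ℝ)) :
    ∃ c : Fin I.length → Fin d → ℤ, (∀ i k, |(c i k : ℝ)| ≤ 1) ∧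
      s.sum = ∑ i, ∑ k, (c i k : ℝ) * I.get i k := by
  induction I generalizing s with
  | nil =>
    obtain rfl : s = 0 := by simpa [norms] using hs
    exact ⟨fun _ _ => 0, by simp, by simp⟩
  | cons v I ih =>
    have hI' : ∀ w ∈ I, IsItem w := fun w hw => hI w (by simp [hw])
    have e : ∀ (a : Fin d → ℤ) (c : Fin I.length → Fin d → ℤ),
        ∑ i : Fin (v :: I).length, ∑ k, (((Fin.cons a c : Fin (I.length + 1) → Fin d → ℤ) i k : ℤ) : ℝ)
          * (v :: I).get i k = ∑ k, (a k : ℝ) * v k + ∑ i, ∑ k, (c i k : ℝ) * I.get i k :=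
      fun a c => Fin.sum_univ_succ _
    have hs' : s ≤ ‖v‖ ::ₘ (norms I : Multiset ℝ) := hs
    by_cases hv : ‖v‖ ∈ s
    · obtain ⟨t, rfl⟩ := Multiset.exists_cons_of_mem hv
      obtain ⟨c, hc, hsum⟩ := ih hI' ((Multiset.cons_le_cons_iff _).1 hs')
      obtain ⟨k, hk, -⟩ := exists_norm_eq hd (hI v (by simp))
      refine ⟨Fin.cons (Pi.single k 1) c, fun i => ?_, ?_⟩
      · refine Fin.cases (fun l => ?_) (fun i l => ?_) i
        · rw [Fin.cons_zero]
          by_cases hl : l = k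
          · subst hl; simp
          · simp [Pi.single_eq_of_ne hl]
        · rw [Fin.cons_succ]; exact hc i l
      · rw [Multiset.sum_cons, e, ← hsum, hk]
        congr 1
        rw [Finset.sum_eq_single k]
        · simp
        · intro l _ hl; simp [Pi.single_eq_of_ne hl]
        · simp
    · obtain ⟨c, hc, hsum⟩ := ih hI' ((Multiset.le_cons_of_notMem hv).1 hs')
      refine ⟨Fin.cons 0 c, fun i => ?_, ?_⟩
      · refine Fin.cases (fun l => ?_) (fun i l => ?_) i
        · simp
        · rw [Fin.cons_succ]; exact hc i l
      · rw [e, ← hsum]; simp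

section Memory

variable {d m r : ℕ} {I H : List (Fin d → ℝ)} {M : Meta d m} {g : Fin m → List Tup}
  {small : List ℝ} {mg : Option (Fin m)}

lemma facts_consequences {pc : PC d m} {rest : List (Fin d → ℝ)} {nums : List ℝ}
    (h : pc.Facts I H rest g small nums) :
    (∃ R, I = H ++ R) ∧ (nums = [] ∨ nums = small.sum :: flat g) := by
  cases pc with
  | init => exact ⟨⟨_, h.2.2.2⟩, .inl h.1⟩
  | scan _ _ => exact ⟨⟨_, h.2.1⟩, .inr h.1⟩
  | classify _ _ => exact ⟨⟨_, h.2.1⟩, .inr h.1⟩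
  | small _ => exact ⟨⟨_, h.2.1⟩, .inr h.1⟩
  | locate _ _ _ => exact ⟨⟨_, h.2.1⟩, .inr h.1⟩
  | insert _ _ _ => exact ⟨⟨_, h.2.1⟩, .inr h.1⟩
  | merge _ => exact ⟨⟨_, h.2.1⟩, .inr h.1⟩
  | done => exact ⟨⟨_, h.2.1⟩, .inr h.1⟩

lemma mem_flat {x : ℝ} (hx : x ∈ flat g) : x ∈ itemsOf g := by
  obtain ⟨l, hl, hx⟩ := List.mem_flatten.1 hx
  obtain ⟨j, rfl⟩ := (List.mem_ofFn' _ _).1 hl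
  obtain ⟨t, ht, rfl⟩ := List.mem_map.1 hx
  refine Multiset.mem_sum.2 ⟨j, Finset.mem_univ j, ?_⟩
  exact List.mem_map.2 ⟨(t.val, t.time), mem_allItems.2 ⟨t, ht, .inl rfl⟩, rfl⟩

lemma Data.card_le (h : Data r H M.cls g small mg) (j : Fin m) :
    (allItems (g j)).length ≤ H.length := by
  have h1 := congrArg Multiset.card h.items
  simp only [Multiset.card_add, itemsOf, Multiset.card_sum, Multiset.coe_card, norms,
    List.length_map] at h1
  have h2 : (allItems (g j)).length ≤ ∑ i, (allItems (g i)).length :=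
    Finset.single_le_sum (f := fun i => (allItems (g i)).length) (fun _ _ => Nat.zero_le _)
      (Finset.mem_univ j)
  omega

lemma length_le_allItems (l : List Tup) : l.length ≤ (allItems l).length := by
  induction l with
  | nil => simp
  | cons t l ih => simp [Tup.items]; omega

lemma abs_length_lt_allItems {l : List Tup} {t : Tup} (ht : t ∈ l) :
    t.abs.length + 1 ≤ (allItems l).length := by
  induction l with
  | nil => simp at ht
  | cons u l ih =>
    rcases List.mem_cons.1 ht with rfl | ht
    · simp [Tup.items]
    · have := ih ht
      simp; omega

lemma Data.mem_enc_le (h : Data r H M.cls g small mg) (j : Fin m) {n : ℕ}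
    (hn : n ∈ (M.cls j).enc) : n ≤ H.length := by
  have hc := h.cls j
  have hcard := h.card_le j
  have htime : (M.cls j).time + (M.cls j).cnt ≤ (allItems (g j)).length := by
    rw [hc.card]; have := le_arrived r m j (M.cls j).time; omega
  simp only [Cls.enc, List.mem_cons, encPairs, List.mem_flatMap, List.not_mem_nil, or_false] at hn
  rcases hn with rfl | rfl | rfl | ⟨p, hp, hn⟩
  · omega
  · omega
  · rw [hc.code, List.length_map]
    exact (length_le_allItems _).trans hcard
  · rw [hc.code] at hp
    obtain ⟨t, ht, rfl⟩ := List.mem_map.1 hp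
    have h1 := abs_length_lt_allItems ht
    have h2 := hc.valid.time_le ht
    simp only [Tup.code] at hn
    omega

lemma facts_mem_enc_le {pc : PC d m} {rest : List (Fin d → ℝ)} {nums : List ℝ}
    (h : pc.Facts I H rest g small nums) (hg : ∀ j, (g j).length ≤ H.length) {n : ℕ}
    (hn : n ∈ pc.enc) : n ≤ 7 + d + m + H.length := by
  cases pc with
  | locate best j pos =>
    obtain ⟨-, -, v, -, -, -, A, C, hgj, hA, -⟩ := h
    have := hg j
    rw [hgj, List.length_append] at this
    simp [PC.enc] at hn
    omega
  | insert best j pos =>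
    obtain ⟨-, -, v, -, -, -, A, C, hgj, hA, -⟩ := h
    have := hg j
    rw [hgj, List.length_append] at this
    simp [PC.enc] at hn
    omega
  | _ => simp [PC.enc] at hn; omega

lemma Inv.ints_le {s : Memory} {rest : List (Fin d → ℝ)} (h : Inv r I M s rest) :
    ∀ n ∈ s.ints, n ≤ 7 + d + m + I.length := by
  obtain ⟨hs, g, small, H, hD, hf⟩ := h
  obtain ⟨⟨R, hR⟩, -⟩ := facts_consequences hf
  have hlen : H.length ≤ I.length := by simp [hR]
  intro n hn
  rw [hs, Meta.enc, List.mem_append] at hn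
  rcases hn with hn | hn
  · have := facts_mem_enc_le hf (fun j => (length_le_allItems _).trans (hD.card_le j)) hn
    omega
  · obtain ⟨c, hc, hn⟩ := List.mem_flatMap.1 hn
    obtain ⟨j, rfl⟩ := (List.mem_ofFn' _ _).1 hc
    have := hD.mem_enc_le j hn
    omega

lemma Inv.nums_coeff (hd : 0 < d) (hI : ∀ v ∈ I, IsItem v) {s : Memory}
    {rest : List (Fin d → ℝ)} (h : Inv r I M s rest) :
    ∀ x ∈ s.nums, ∃ c : Fin I.length → Fin d → ℤ, (∀ i k, |(c i k : ℝ)| ≤ 1) ∧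
      x = ∑ i, ∑ k, (c i k : ℝ) * I.get i k := by
  obtain ⟨hs, g, small, H, hD, hf⟩ := h
  obtain ⟨⟨R, hR⟩, hnums⟩ := facts_consequences hf
  have hHI : (norms H : Multiset ℝ) ≤ (norms I : Multiset ℝ) := by
    rw [hR, norms, norms, List.map_append, ← Multiset.coe_add]
    exact Multiset.le_add_right _ _
  intro x hx
  rcases hnums with h0 | h0
  · simp [h0] at hx
  rw [h0] at hx
  rcases List.mem_cons.1 hx with rfl | hx
  · have := exists_coeff hd hI (s := (small : Multiset ℝ)) (le_trans ?_ hHI)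
    · simpa using this
    · rw [← hD.items]; exact Multiset.le_add_right _ _
  · have := exists_coeff hd hI (s := {x}) (le_trans ?_ hHI)
    · simpa using this
    · rw [Multiset.singleton_le, ← hD.items, Multiset.mem_add]
      exact .inr (mem_flat hx)

lemma length_encPairs (l : List (ℕ × ℕ)) : (encPairs l).length = 2 * l.length := by
  induction l with
  | nil => rfl
  | cons p l ih =>
    simp only [encPairs, List.flatMap_cons, List.length_append, List.length_cons] at ih ⊢
    simp; omega

lemma Inv.words_le {s : Memory} {rest : List (Fin d → ℝ)} (h : Inv r I M s rest) {B : ℕ}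
    (hB : ∀ j, (M.cls j).tl.length ≤ B) : s.words ≤ 5 + m * (3 + 3 * B) := by
  obtain ⟨hs, g, small, H, hD, hf⟩ := h
  obtain ⟨-, hnums⟩ := facts_consequences hf
  have hn : s.nums.length ≤ ∑ j, (M.cls j).tl.length + 1 := by
    have : tuples M.cls = ∑ j, (M.cls j).tl.length := by
      rw [tuples, List.map_ofFn, List.sum_ofFn]; rfl
    rw [← this]
    rcases hnums with h0 | h0
    · simp [h0]
    · rw [h0, hD.nums_length]
  have hi : s.ints.length = 4 + ∑ j, (3 + 2 * (M.cls j).tl.length) := by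
    rw [hs, Meta.enc, List.length_append, PC.enc_length, List.length_flatMap, List.map_ofFn,
      List.sum_ofFn]
    congr 1
    refine Finset.sum_congr rfl fun j _ => ?_
    simp only [Function.comp, Cls.enc, List.length_cons, length_encPairs]
    omega
  have hsum : ∑ j, (3 + 2 * (M.cls j).tl.length) + ∑ j, (M.cls j).tl.length ≤
      m * (3 + 3 * B) := by
    rw [← Finset.sum_add_distrib]
    refine (Finset.sum_le_card_nsmul _ _ (3 + 3 * B) fun j _ => ?_).trans (by simp)
    have := hB j
    omega
  rw [Memory.words]
  omega

lemma Data.card_le_volume (h : Data r H M.cls g small mg) {K : ℕ}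
    (hK : (norms H : Multiset ℝ).sum ≤ K) (j : Fin m) :
    (allItems (g j)).length ≤ 2 ^ ((j : ℕ) + 1) * K := by
  have h1 := (h.cls j).card_le_sum
  have h2 : ((allItems (g j)).map Prod.fst).sum ≤ (itemsOf g).sum := by
    rw [itemsOf_sum]
    refine Finset.single_le_sum (f := fun i => ((allItems (g i)).map Prod.fst).sum)
      (fun i _ => List.sum_nonneg fun x hx => ?_) (Finset.mem_univ j)
    obtain ⟨y, hy, rfl⟩ := List.mem_map.1 hx
    exact le_trans (by positivity) ((h.cls i).range y hy).1.le
  have h3 := h.sum_norms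
  have h4 := h.small_sum_nonneg
  have h5 : (2 : ℝ) ^ ((j : ℕ) + 1) * ((allItems (g j)).map Prod.fst).sum ≤
      2 ^ ((j : ℕ) + 1) * K := mul_le_mul_of_nonneg_left (by linarith) (by positivity)
  exact_mod_cast h1.trans h5

end Memory

/-- The number of tuples of a class, in terms of the optimum. -/
lemma sizeBound_add_blockSize_le {d r m j T n P : ℕ} (hm : m = 2 * r) (hj : j < m)
    (hd : 16 * d ≤ 2 ^ m) (hT : arrived r m j T ≤ n) (hn : n ≤ 2 ^ (j + 1) * (d * P)) :
    sizeBound r m j T + blockSize r m j T ≤ 73 * 2 ^ m * Nat.log 2 (2 + P) := by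
  set L := Nat.log 2 (2 + P) with hL
  have hL1 : 1 ≤ L := Nat.log_pos (by norm_num) (by omega)
  have hmr : 2 ^ m = 2 ^ r * 2 ^ r := by rw [hm, two_mul, pow_add]
  have hq : 0 < 2 ^ r := by positivity
  have hj0 : 0 < 2 ^ j := by positivity
  have hjm : 2 ^ j ≤ 2 ^ m := Nat.pow_le_pow_right (by norm_num) hj.le
  unfold sizeBound blockSize
  split_ifs with hlt
  -- Short blocks: `T < 2 ^ (4 * r)`, so there are at most `4 * r` levels, each with `O(2 ^ r)`
  -- tuples, and `r * 2 ^ r ≤ 2 ^ m` needs no help from `P`.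
  · have hrq : r + 1 ≤ 2 ^ r := Nat.lt_two_pow_self
    have hr : 1 ≤ r := by omega
    have hlog : Nat.log 2 T + 1 ≤ 4 * r := by
      rcases Nat.eq_zero_or_pos T with rfl | hT0
      · simp; omega
      · have : T < 2 ^ (4 * r) := by
          calc T < 2 ^ j * 2 ^ m := hlt
            _ ≤ 2 ^ m * 2 ^ m := Nat.mul_le_mul_right _ hjm
            _ = 2 ^ (4 * r) := by rw [← pow_add, hm]; congr 1; ring
        exact Nat.log_lt_of_lt_pow (by omega) this
    calc (Nat.log 2 T + 1) * (8 * 2 ^ r + 1) + 2 ^ r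
        ≤ (4 * 2 ^ r) * (9 * 2 ^ r) + 2 ^ r * 2 ^ r := by
          refine Nat.add_le_add (Nat.mul_le_mul (by omega) (by omega)) ?_
          exact Nat.le_mul_of_pos_left _ hq
      _ = 37 * 2 ^ m := by rw [hmr]; ring
      _ ≤ 73 * 2 ^ m * L := by nlinarith [Nat.mul_le_mul_left (73 * 2 ^ m) hL1]
  -- Long blocks: the arrivals during the short blocks alone force `8 * 2 ^ r ≤ P`. Hence `2 ^ m` is
  -- below `(2 + P) ^ 2`, `T` is at most `(2 + P) ^ 4`, and the number of levels is `O(log P)`.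
  · have hlt := not_lt.1 hlt
    have harr := hT.trans hn
    rw [arrived, min_eq_right hlt] at harr
    have h1 : 2 ^ j * (2 ^ r * 2 ^ m) ≤ 2 ^ j * (2 * (d * P)) := by
      rw [pow_succ] at harr; nlinarith [Nat.zero_le (2 ^ m * (T - 2 ^ j * 2 ^ m))]
    have h1 := Nat.le_of_mul_le_mul_left h1 hj0
    have hdP : 16 * (d * P) ≤ 2 ^ m * P := by rw [← mul_assoc]; exact Nat.mul_le_mul_right _ hd
    have h2 : 2 ^ m * (8 * 2 ^ r) ≤ 2 ^ m * P := by nlinarith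
    have h2 := Nat.le_of_mul_le_mul_left h2 (by positivity)
    have h3 : 2 ^ m * (T - 2 ^ j * 2 ^ m) ≤ 2 ^ m * (2 ^ j * P) := by
      have : 2 ^ (j + 1) * (d * P) ≤ 2 ^ m * (2 ^ j * P) := by
        rw [pow_succ]
        nlinarith [Nat.mul_le_mul_left (2 ^ j) hdP, Nat.zero_le (2 ^ j * (d * P))]
      have := Nat.zero_le (2 ^ r * (2 ^ j * 2 ^ m))
      omega
    have h3 := Nat.le_of_mul_le_mul_left h3 (by positivity)
    have hP : 2 ^ r ≤ 2 + P := by omega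
    have hb : 2 ^ m ≤ (2 + P) * (2 + P) := by rw [hmr]; exact Nat.mul_le_mul hP hP
    have hTle : T ≤ (2 + P) ^ 4 := by
      calc T ≤ 2 ^ j * 2 ^ m + 2 ^ j * P := by omega
        _ = 2 ^ j * (2 ^ m + P) := by ring
        _ ≤ ((2 + P) * (2 + P)) * ((2 + P) * (2 + P)) := by
          refine Nat.mul_le_mul (hjm.trans hb) ?_
          rw [hmr]
          nlinarith
        _ = (2 + P) ^ 4 := by ring
    have hPL : 2 + P < 2 ^ (L + 1) := Nat.lt_pow_succ_log_self (by norm_num) _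
    have hlog : Nat.log 2 T + 1 ≤ 8 * L := by
      rcases Nat.eq_zero_or_pos T with rfl | hT0
      · simp; omega
      · have : T < 2 ^ (4 * (L + 1)) := by
          calc T ≤ (2 + P) ^ 4 := hTle
            _ < (2 ^ (L + 1)) ^ 4 := Nat.pow_lt_pow_left hPL (by norm_num)
            _ = 2 ^ (4 * (L + 1)) := by rw [← pow_mul]; congr 1; ring
        have := Nat.log_lt_of_lt_pow (by omega) this
        omega
    have hm1 : 1 ≤ 2 ^ m := Nat.one_le_two_pow
    calc (Nat.log 2 T + 1) * (8 * 2 ^ m + 1) + 2 ^ m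
        ≤ (8 * L) * (9 * 2 ^ m) + 2 ^ m * L :=
          Nat.add_le_add (Nat.mul_le_mul hlog (by omega)) (Nat.le_mul_of_pos_right _ hL1)
      _ = 73 * 2 ^ m * L := by ring

/-- The size of the memory of the algorithm. -/
lemma Inv.words_le_log {d m r : ℕ} [NeZero d] {I : List (Fin d → ℝ)} {M : Meta d m}
    {s : Memory} {rest : List (Fin d → ℝ)} (h : Inv r I M s rest) (hI : ∀ v ∈ I, IsItem v)
    (hm : m = 2 * r) (hm0 : 0 < m) (hd : 16 * d ≤ 2 ^ m) :
    s.words ≤ 227 * (m * 2 ^ m * Nat.log 2 (2 + OPT I)) := by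
  have hK := packs_norms (NeZero.pos d) hI (canPack_OPT hI)
  set L := Nat.log 2 (2 + OPT I) with hL
  have hL1 : 1 ≤ L := Nat.log_pos (by norm_num) (by omega)
  have h' := h
  obtain ⟨hs, g, small, H, hD, hf⟩ := h'
  obtain ⟨⟨R, hR⟩, -⟩ := facts_consequences hf
  have hHK : (norms H : Multiset ℝ).sum ≤ ((d * OPT I : ℕ) : ℝ) := by
    refine le_trans ?_ hK.sum_le
    rw [hR, norms, norms, List.map_append, ← Multiset.coe_add, Multiset.sum_add]
    refine le_add_of_nonneg_right (Multiset.sum_nonneg fun x hx => ?_)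
    obtain ⟨v, -, rfl⟩ := List.mem_map.1 (Multiset.mem_coe.1 hx)
    exact norm_nonneg v
  have hw := h.words_le (B := 73 * 2 ^ m * L) fun j => by
    have hc := hD.cls j
    have hb := sizeBound_add_blockSize_le (P := OPT I) hm j.2 hd
      (T := (M.cls j).time) (by rw [hc.card]; exact Nat.le_add_right _ _)
      (hD.card_le_volume hHK j)
    rw [hc.code, List.length_map]
    by_cases hmg : M.pc.merging = some j
    · exact (hc.len_mg hmg).trans hb
    · exact ((hc.len hmg).trans (Nat.add_le_add_left hc.cnt_lt.le _)).trans hb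
  have h1 : 1 ≤ m * 2 ^ m * L := Nat.mul_pos (Nat.mul_pos hm0 (by positivity)) hL1
  have h2 : m ≤ m * 2 ^ m * L := by
    rw [mul_assoc]; exact Nat.le_mul_of_pos_right _ (Nat.mul_pos (by positivity) hL1)
  -- With `1` and `m` both at most `m * 2 ^ m * L`, the constants add up to `5 + 3 + 219 = 227`.
  have e : m * (3 + 3 * (73 * 2 ^ m * L)) = 3 * m + 219 * (m * 2 ^ m * L) := by ring
  rw [e] at hw
  omega

/-! ### The choice of the parameters -/

/-- A power of four is needed, since `m` must be even for `2 ^ r` to be the square root of `2 ^ m`;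
this is the factor `4` between the bounds. -/
lemma exists_exponent {x : ℝ} (hx : 1 ≤ x) :
    ∃ r : ℕ, 0 < r ∧ 16 * x ≤ 2 ^ (2 * r) ∧ (2 : ℝ) ^ (2 * r) ≤ 64 * x := by
  obtain ⟨n, h1, h2⟩ := exists_nat_pow_near (x := 16 * x) (y := 4) (by linarith) (by norm_num)
  refine ⟨n + 1, by omega, ?_, ?_⟩
  · rw [pow_mul]; norm_num; linarith
  · rw [pow_mul, pow_succ]; norm_num; linarith

lemma log_two_ge_half : (1 / 2 : ℝ) ≤ Real.log 2 := by
  have := Real.log_two_gt_d9; linarith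

lemma exponent_le_log {x : ℝ} (hx : 1 ≤ x) {m : ℕ} (hm : (2 : ℝ) ^ m ≤ 64 * x) :
    (m : ℝ) ≤ 12 * Real.log (2 + x) := by
  have h1 : Real.log ((2 : ℝ) ^ m) ≤ Real.log ((2 + x) ^ 6) := by
    refine Real.log_le_log (by positivity) (hm.trans ?_)
    have h3 : (3 : ℝ) ^ 5 ≤ (2 + x) ^ 5 := pow_le_pow_left₀ (by norm_num) (by linarith) 5
    rw [pow_succ]
    nlinarith
  rw [Real.log_pow, Real.log_pow] at h1
  push_cast at h1
  have h2 := mul_le_mul_of_nonneg_left log_two_ge_half (Nat.cast_nonneg (α := ℝ) m)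
  linarith

lemma natLog_le_log (P : ℕ) : (Nat.log 2 (2 + P) : ℝ) ≤ 2 * Real.log (2 + P) := by
  have h1 : ((2 ^ Nat.log 2 (2 + P) : ℕ) : ℝ) ≤ ((2 + P : ℕ) : ℝ) :=
    Nat.cast_le.2 (Nat.pow_log_le_self 2 (by omega))
  push_cast at h1
  have h2 := Real.log_le_log (by positivity) h1
  rw [Real.log_pow] at h2
  have h3 := mul_le_mul_of_nonneg_left log_two_ge_half
    (Nat.cast_nonneg (α := ℝ) (Nat.log 2 (2 + P)))
  linarith

lemma le_spaceBound {d : ℕ} {ε : ℝ} (hx : 1 ≤ (d : ℝ) / ε) {m : ℕ}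
    (hm : (2 : ℝ) ^ m ≤ 64 * (d / ε)) (P : ℕ) :
    (m : ℝ) * 2 ^ m * Nat.log 2 (2 + P) ≤ 1536 * spaceBound d ε P := by
  have h1 := exponent_le_log hx hm
  have h2 := natLog_le_log P
  have hl : 0 ≤ Real.log (2 + d / ε) := Real.log_nonneg (by linarith)
  calc (m : ℝ) * 2 ^ m * Nat.log 2 (2 + P)
      ≤ (12 * Real.log (2 + d / ε)) * (64 * (d / ε)) * (2 * Real.log (2 + P)) := by gcongr
    _ = 1536 * spaceBound d ε P := by rw [spaceBound]; ring

end VBP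

theorem mainTheorem3 :
    (∃ (C : ℝ) (c : ℕ), ∀ (d : ℕ) (ε : ℝ), 0 < d → 0 < ε → ε ≤ 1 →
      ∃ A : VBP.StreamingAlgorithm d, ∀ I : List (Fin d → ℝ), (∀ v ∈ I, VBP.IsItem v) →
        (∀ (s : VBP.Memory) (rest : List (Fin d → ℝ)), A.Reaches I s rest →
          (s.words : ℝ) ≤ C * VBP.spaceBound d ε (VBP.OPT I) ∧
          s.FitsInWords I (((I.length : ℝ) + d + 1 / ε + 2) ^ c)) ∧
        ∃ s : VBP.Memory, A.Reaches I s [] ∧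
          VBP.OPT I ≤ A.output s ∧
          (A.output s : ℝ) ≤
            (d + ε) * (VBP.OPT I : ℝ) + C * VBP.spaceBound d ε (VBP.OPT I)) ∧
    (∀ (d : ℕ), 0 < d → ∀ I : List (Fin d → ℝ), (∀ v ∈ I, VBP.IsItem v) →
      VBP.OPT (VBP.scalarInstance I) ≤ d * VBP.OPT I) := by
  -- `227` comes from `Inv.words_le_log` and `1536` from `le_spaceBound`. The exponent `6` absorbs
  -- the bound `64 * y ^ 2` on `m`, through `256 * y ^ 2 ≤ y ^ 6` for `y ≥ 4`.
  refine ⟨⟨227 * 1536, 6, fun d ε hd hε hε1 => ?_⟩,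
    fun d hd I hI => VBP.OPT_scalarInstance_le hd hI⟩
  have : NeZero d := ⟨hd.ne'⟩
  have hd1 : (1 : ℝ) ≤ d := by exact_mod_cast hd
  have hx : 1 ≤ (d : ℝ) / ε := by rw [le_div_iff₀ hε]; linarith
  obtain ⟨r, hr, hlo, hhi⟩ := VBP.exists_exponent hx
  set m := 2 * r with hm
  have hm0 : 0 < m := by omega
  have : NeZero m := ⟨hm0.ne'⟩
  have hrm : r ≤ m := by omega
  have hddε : (d : ℝ) ≤ d / ε := by
    rw [le_div_iff₀ hε]; nlinarith
  have hd16 : 16 * d ≤ 2 ^ m := by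
    have : (16 : ℝ) * d ≤ 2 ^ m := by linarith
    exact_mod_cast this
  have hb : (16 : ℝ) ≤ 2 ^ m := by linarith
  refine ⟨VBP.algorithm d m r, fun I hI => ⟨fun s rest hreach => ?_, ?_⟩⟩
  · obtain ⟨M, hinv⟩ := VBP.inv_of_reaches hrm hI hreach
    have hspace := VBP.le_spaceBound hx hhi (VBP.OPT I)
    refine ⟨?_, ?_, ?_⟩
    · have hw := hinv.words_le_log hI hm hm0 hd16
      have hw' : (s.words : ℝ) ≤ 227 * ((m : ℝ) * 2 ^ m * Nat.log 2 (2 + VBP.OPT I)) := by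
        exact_mod_cast hw
      linarith
    · intro n hn
      have h1 := hinv.ints_le n hn
      have h2 : (n : ℝ) ≤ 7 + d + m + I.length := by exact_mod_cast h1
      have hε' : 1 ≤ 1 / ε := by rw [le_div_iff₀ hε]; linarith
      have hN : (0 : ℝ) ≤ I.length := Nat.cast_nonneg _
      set y : ℝ := (I.length : ℝ) + d + 1 / ε + 2 with hy
      have hy4 : 4 ≤ y := by linarith
      have h3 : (m : ℝ) ≤ 64 * y ^ 2 := by
        have h4 : (m : ℝ) ≤ 2 ^ m := by exact_mod_cast Nat.lt_two_pow_self.le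
        have h5 : (d : ℝ) / ε ≤ y * y := by
          rw [div_eq_mul_one_div]
          exact mul_le_mul (by linarith) (by linarith) (by linarith) (by linarith)
        nlinarith
      have h6 : (256 : ℝ) * y ^ 2 ≤ y ^ 6 := by
        have : (4 : ℝ) ^ 4 ≤ y ^ 4 := pow_le_pow_left₀ (by norm_num) hy4 4
        have e : y ^ 6 = y ^ 4 * y ^ 2 := by ring
        rw [e]
        exact mul_le_mul_of_nonneg_right (by linarith) (by positivity)
      nlinarith
    · intro x hx'
      obtain ⟨c, hc, hsum⟩ := hinv.nums_coeff hd hI x hx'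
      refine ⟨c, fun i k => (hc i k).trans (one_le_pow₀ ?_), hsum⟩
      have : 0 < 1 / ε := by positivity
      have hN : (0 : ℝ) ≤ I.length := Nat.cast_nonneg _
      linarith
  · obtain ⟨s, hreach⟩ := VBP.exists_reaches (m := m) (r := r) hrm hI
    obtain ⟨M, hs, g, small, H, hD, hf⟩ := VBP.inv_of_reaches hrm hI hreach
    obtain ⟨htail, hhead, rfl⟩ := VBP.headD_tail_of_facts hf
    have hR := VBP.rounded_eq M g s.nums htail fun j => (hD.cls j).code
    have hK := VBP.packs_norms hd hI (VBP.canPack_OPT hI)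
    refine ⟨s, hreach, ?_, ?_⟩
    · rw [VBP.algorithm_output r M hs]
      exact VBP.OPT_le_answer hD hm0 hK hR hhead hb
    · rw [VBP.algorithm_output r M hs]
      have hans := VBP.answer_le hD hm0 hK hR hhead hb
      have hspace := VBP.le_spaceBound hx hhi (VBP.OPT I)
      have hL1 : 1 ≤ Nat.log 2 (2 + VBP.OPT I) := Nat.log_pos (by norm_num) (by omega)
      have hL1' : (1 : ℝ) ≤ Nat.log 2 (2 + VBP.OPT I) := by exact_mod_cast hL1
      have hmR : (1 : ℝ) ≤ m := by exact_mod_cast hm0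
      have hmb : (1 : ℝ) ≤ m * 2 ^ m := by nlinarith
      have hS : (m : ℝ) * 2 ^ m ≤ 1536 * VBP.spaceBound d ε (VBP.OPT I) := by
        refine le_trans ?_ hspace
        exact le_mul_of_one_le_right (by positivity) hL1'
      have hO : (0 : ℝ) ≤ VBP.OPT I := Nat.cast_nonneg _
      -- The relative error `5 / 2 ^ m` applies to `d * OPT` bins, and `2 ^ m ≥ 16 * d / ε` brings
      -- it below `ε * OPT`.
      have herr : 5 * ((d * VBP.OPT I : ℕ) : ℝ) / 2 ^ m ≤ ε * VBP.OPT I := by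
        rw [div_le_iff₀ (by positivity)]
        push_cast
        have : 16 * (d : ℝ) ≤ ε * 2 ^ m := by
          have := mul_le_mul_of_nonneg_left hlo hε.le
          rw [show ε * (16 * ((d : ℝ) / ε)) = 16 * d by field_simp] at this
          exact this
        nlinarith [mul_le_mul_of_nonneg_right this hO, mul_nonneg (Nat.cast_nonneg (α := ℝ) d) hO]
      push_cast at hans herr
      linarith
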